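/- For a domain (non-empty open set) $G\subset\mathbb{R}^n$, $j\in\mathbb{N}_0$ and $w\in L^1_{\rm loc}(G)$ with weak derivatives up to order $j$ in $L^2(G)$, let $|w|_{W^j(G)}=\big(\sum_{|\alpha|=j}\|D^\alpha w\|_{L^2(G)}^2\big)^{1/2}$ and $\|w\|_{W^j(G)}=\big(\sum_{i=0}^j|w|_{W^i(G)}^2\big)^{1/2}$, with $\|w\|_{W^j(G)}=\infty$ if $w$ does not have such weak derivatives. Let $H^m(\mathbb{R}^n)$ be the Bessel potential space of tempered distributions $U$ with $\int_{\mathbb{R}^n}(1+|\xi|^2)^m|\hat U(\xi)|^2\,d\xi<\infty$ (so $H^m(\mathbb{R}^n)=W^m(\mathbb{R}^n)$ for $m\in\mathbb{N}$), and let $H^m(\Omega)=\{U|_\Omega: U\in H^m(\mathbb{R}^n)\}$. Functions are complex-valued. A mesh $\mathcal{T}$ of a domain $\Omega$ is a countable collection of non-empty, bounded, pairwise disjoint open subsets of $\Omega$ whose union covers $\Omega$ up to a set of Lebesgue measure zero; its meshwidth is $h=\sup_{K\in\mathcal{T}}\operatorname{diam}(K)$. For $p\in\mathbb{N}_0$ let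 $V_{h,p}$ be the set of $v\in L^2(\Omega)$ such that, for each $K\in\mathcal{T}$, $v|_K$ is a polynomial of total degree at most $p$. **Theorem.** Let $n,m\in\mathbb{N}$ (so $n,m\ge 1$) and $h_0>0$. There exists a constant $C>0$, depending only on $n$, $h_0$ and $m$, such that if $\Omega\subset\mathbb{R}^n$ is a domain, $\mathcal{T}$ is a mesh of $\Omega$ with meshwidth $h\in(0,h_0]$, $u\in H^m(\Omega)$, $U\in H^m(\mathbb{R}^n)$ satisfies $U|_\Omega=u$, and $p\in\mathbb{N}_0$, then, with $t:=\min(m,p+1)$, for every $j=0,1,\ldots,m$ the minimum below is attained and $$\min_{v\in V_{h,p}}\Big(\sum_{K\in\mathcal{T}}\|u-v\|_{W^j(K)}^2\Big)^{1/2}\le C\,\frac{h^{t-j}}{(p+1)^{m-j}}\sum_{r=t}^m|U|_{W^r(\mathbb{R}^n)}.$$ -/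

import Mathlib

open MeasureTheory
open scoped ENNReal ContDiff

noncomputable section

namespace PiecewisePoly

/-- `ℝⁿ` with its Euclidean norm. -/
abbrev Space (n : ℕ) : Type := EuclideanSpace ℝ (Fin n)

/-! ### Weak derivatives and the Sobolev norms of `W^j` -/

/-- The classical partial derivative `∂_i φ`. -/
def partialDeriv {n : ℕ} (i : Fin n) (φ : Space n → ℂ) : Space n → ℂ :=
  fun x => fderiv ℝ φ x (EuclideanSpace.single i 1)

/-- The classical derivative `D^α φ = ∂_1^{α_1} ⋯ ∂_n^{α_n} φ` for a multi-index `α`. -/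
def multiDeriv {n : ℕ} (α : Fin n → ℕ) (φ : Space n → ℂ) : Space n → ℂ :=
  (List.finRange n).foldr (fun i ψ => (partialDeriv i)^[α i] ψ) φ

/-- `φ ∈ C_0^∞(G)`: smooth with compact support contained in `G`. -/
structure IsTestFunction {n : ℕ} (G : Set (Space n)) (φ : Space n → ℂ) : Prop where
  smooth : ContDiff ℝ ∞ φ
  compact : HasCompactSupport φ
  support : tsupport φ ⊆ G

/-- `g` is the weak derivative `D^α w` on the open set `G`. -/
structure HasWeakDeriv {n : ℕ} (G : Set (Space n)) (α : Fin n → ℕ) (w g : Space n → ℂ) :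
    Prop where
  locallyIntegrable : LocallyIntegrableOn w G volume
  locallyIntegrable_deriv : LocallyIntegrableOn g G volume
  integral_eq : ∀ φ : Space n → ℂ, IsTestFunction G φ →
    ∫ x in G, w x * multiDeriv α φ x = (-1) ^ (∑ i, α i) * ∫ x in G, g x * φ x

/-- `‖D^α w‖_{L²(G)}`, with the value `∞` if `w` has no weak derivative `D^α w` on `G`
(weak derivatives being unique almost everywhere, the infimum is over at most one value). -/
def weakDerivNorm {n : ℕ} (G : Set (Space n)) (α : Fin n → ℕ) (w : Space n → ℂ) : ℝ≥0∞ :=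
  ⨅ (g : Space n → ℂ) (_ : HasWeakDeriv G α w g), eLpNorm g 2 (volume.restrict G)

/-- `|w|_{W^j(G)} = (∑_{|α| = j} ‖D^α w‖²_{L²(G)})^{1/2}`. -/
def sobolevSeminorm {n : ℕ} (G : Set (Space n)) (j : ℕ) (w : Space n → ℂ) : ℝ≥0∞ :=
  (∑ α ∈ Finset.piAntidiag (Finset.univ : Finset (Fin n)) j, weakDerivNorm G α w ^ 2) ^ (1 / 2 : ℝ)

/-- `‖w‖_{W^j(G)} = (∑_{i ≤ j} |w|²_{W^i(G)})^{1/2}`. -/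
def sobolevNorm {n : ℕ} (G : Set (Space n)) (j : ℕ) (w : Space n → ℂ) : ℝ≥0∞ :=
  (∑ i ∈ Finset.range (j + 1), sobolevSeminorm G i w ^ 2) ^ (1 / 2 : ℝ)

/-! ### The spaces `H^m` -/

/-- `U ∈ H^m(ℝⁿ)`, the Bessel potential space: the tempered distribution given by the
`L²` function `U` satisfies `∫ (1 + |ξ|²)^m |Û(ξ)|² dξ < ∞`. -/
def MemH {n : ℕ} (m : ℕ) (U : Space n → ℂ) : Prop :=
  ∃ hU : MemLp U 2 (volume : Measure (Space n)),
    TemperedDistribution.MemSobolev (m : ℝ) 2 (Lp.toTemperedDistribution (hU.toLp U))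

/-- `u ∈ H^m(Ω)`, the space of restrictions to `Ω` of elements of `H^m(ℝⁿ)`. -/
def MemHOn {n : ℕ} (m : ℕ) (Ω : Set (Space n)) (u : Space n → ℂ) : Prop :=
  ∃ U : Space n → ℂ, MemH m U ∧ U =ᵐ[volume.restrict Ω] u

/-! ### Meshes and piecewise polynomials -/

/-- `T` is a mesh of `Ω`. -/
structure IsMesh {n : ℕ} (Ω : Set (Space n)) (T : Set (Set (Space n))) : Prop where
  countable : T.Countable
  nonempty : ∀ K ∈ T, K.Nonempty
  bounded : ∀ K ∈ T, Bornology.IsBounded K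
  isOpen : ∀ K ∈ T, IsOpen K
  subset : ∀ K ∈ T, K ⊆ Ω
  disjoint : ∀ K ∈ T, ∀ K' ∈ T, K ≠ K' → K ∩ K' = ∅
  cover : volume (Ω \ ⋃ K ∈ T, K) = 0

/-- The meshwidth `sup_{K ∈ T} diam K`, as an extended real. -/
def meshWidth {n : ℕ} (T : Set (Set (Space n))) : ℝ≥0∞ :=
  ⨆ K ∈ T, Metric.ediam K

/-- `v` is (almost everywhere) on `K` a polynomial of total degree at most `p`. -/
def IsPolyOn {n : ℕ} (p : ℕ) (K : Set (Space n)) (v : Space n → ℂ) : Prop :=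
  ∃ P : MvPolynomial (Fin n) ℂ, P.totalDegree ≤ p ∧
    v =ᵐ[volume.restrict K] fun x => MvPolynomial.eval (fun i => (x i : ℂ)) P

/-- The space `V_{h,p}` of functions in `L²(Ω)` that are polynomials of total degree at most `p`
on each element of the mesh `T`. -/
def piecewisePoly {n : ℕ} (Ω : Set (Space n)) (T : Set (Set (Space n))) (p : ℕ) :
    Set (Space n → ℂ) :=
  {v | MemLp v 2 (volume.restrict Ω) ∧ ∀ K ∈ T, IsPolyOn p K v}

/-- The broken norm `(∑_{K ∈ T} ‖w‖²_{W^j(K)})^{1/2}`. -/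
def brokenNorm {n : ℕ} (T : Set (Set (Space n))) (j : ℕ) (w : Space n → ℂ) : ℝ≥0∞ :=
  (∑' K : T, sobolevNorm (K : Set (Space n)) j w ^ 2) ^ (1 / 2 : ℝ)

end PiecewisePoly

end

/-!
The local polynomials are found on the Fourier side. Let `W` be the Fourier transform of `U`, let
`N = p + 1` and `t = min m N`. For a centre `b` take the Taylor polynomial around `b`, with the
terms of order less than `N`, of the low-frequency part of `U`:
`T_b(x) = ∫_{|ξ| ≤ R} e^{2πi⟨b, ξ⟩} ∑_{k < N} (2πi⟨x - b, ξ⟩)^k / k! W(ξ) dξ`, where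
`R = N / (8π(n + 2)h)` (`bandTaylor`, `lowPart`). Its derivative `D^α T_b` has the same form, with
`N - |α|` terms and with `(2πiξ)^α W` in place of `W` (`hasWeakDeriv_bandTaylor`).

For a fixed offset `y`, Plancherel's identity in the *centre* `b` turns the mean square over all
`b ∈ ℝⁿ` of the error `D^α U(b + y) - D^α T_b(b + y)` into the norm of `(2πiξ)^α W` times the
multiplier `e^{is} - 1_{|ξ| ≤ R} ∑_{k < N - |α|} (is)^k / k!` with `s = 2π⟨y, ξ⟩`
(`eLpNorm_sub_bandTaylor`, `eLpNorm_error_eq`). If `|y| ≤ (n + 2)h` and `|α| ≤ t`, the multiplier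
is at most a constant times `(h|ξ| / N)^{t - |α|}`: for `|ξ| > R` because it is bounded and
`h|ξ| / N` is bounded below, and for `|ξ| ≤ R` because `|s| ≤ N / 4`, so that the remainder of the
exponential series is small uniformly in `N` (`norm_errorMultiplier_le`). If `|α| > t`, then
`N = t < m`, the polynomial contributes nothing and the crude bound by `|U|_{W^{|α|}}` is enough.
Only the seminorms of order at least `t` enter; no cut-off function and no Poincaré inequality is
needed, and all derivatives are treated at once.

To choose the centres, `ℝⁿ` is divided into grid cells of width `h`, and every element of the mesh
is assigned to a cell that it meets. All elements of a cell share one centre in that cell, chosen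
so that the error is at most its average over the cell. As the elements are disjoint and lie
within distance `(n + 2)h` of the centre, the errors add up to at most
`h^{-n} ∫_{|y| < (n + 2)h} ∫ |D^α U(b + y) - D^α T_b(b + y)|² db dy` (`exists_centers`), whatever
the number and the shapes of the elements.

The minimum is attained because the broken norm can be minimized on each element separately, where
this is an orthogonal projection onto a finite-dimensional subspace of a product of copies of
`L²(K)` (`exists_best_approximation`, `exists_isMinOn_brokenNorm`).
-/

namespace PiecewisePoly

/-! ### Weak derivatives -/

section WeakDerivatives

variable {n : ℕ} {G : Set (Space n)} {φ : Space n → ℂ}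

lemma tsupport_partialDeriv_subset (i : Fin n) (φ : Space n → ℂ) :
    tsupport (partialDeriv i φ) ⊆ tsupport φ :=
  tsupport_fderiv_apply_subset ℝ _

lemma contDiff_partialDeriv (hφ : ContDiff ℝ ∞ φ) (i : Fin n) :
    ContDiff ℝ ∞ (partialDeriv i φ) :=
  (hφ.fderiv_right (m := ∞) (by norm_cast)).clm_apply contDiff_const

lemma contDiff_partialDeriv_iterate (hφ : ContDiff ℝ ∞ φ) (i : Fin n) (k : ℕ) :
    ContDiff ℝ ∞ ((partialDeriv i)^[k] φ) := by
  induction k with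
  | zero => exact hφ
  | succ k ih => rw [Function.iterate_succ_apply']; exact contDiff_partialDeriv ih i

lemma IsTestFunction.partialDeriv (hφ : IsTestFunction G φ) (i : Fin n) :
    IsTestFunction G (partialDeriv i φ) where
  smooth := contDiff_partialDeriv hφ.smooth i
  compact := hφ.compact.mono' ((subset_tsupport _).trans (tsupport_partialDeriv_subset i φ))
  support := (tsupport_partialDeriv_subset i φ).trans hφ.support

lemma IsTestFunction.iterate (hφ : IsTestFunction G φ) (i : Fin n) (k : ℕ) :
    IsTestFunction G ((PiecewisePoly.partialDeriv i)^[k] φ) := by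
  induction k with
  | zero => exact hφ
  | succ k ih => rw [Function.iterate_succ_apply']; exact ih.partialDeriv i

lemma IsTestFunction.foldr (hφ : IsTestFunction G φ) (α : Fin n → ℕ) (l : List (Fin n)) :
    IsTestFunction G (l.foldr (fun i ψ => (PiecewisePoly.partialDeriv i)^[α i] ψ) φ) := by
  induction l with
  | nil => exact hφ
  | cons i l ih => exact ih.iterate i _

lemma IsTestFunction.multiDeriv (hφ : IsTestFunction G φ) (α : Fin n → ℕ) :
    IsTestFunction G (multiDeriv α φ) :=
  hφ.foldr α _

lemma IsTestFunction.mono {G' : Set (Space n)} (hφ : IsTestFunction G φ) (h : G ⊆ G') :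
    IsTestFunction G' φ :=
  ⟨hφ.smooth, hφ.compact, hφ.support.trans h⟩

lemma IsTestFunction.eq_zero (hφ : IsTestFunction G φ) {x : Space n} (hx : x ∉ G) : φ x = 0 :=
  image_eq_zero_of_notMem_tsupport fun h => hx (hφ.support h)

lemma IsTestFunction.setIntegral_mul_eq (hφ : IsTestFunction G φ) (w : Space n → ℂ) :
    ∫ x in G, w x * φ x = ∫ x, w x * φ x :=
  setIntegral_eq_integral_of_forall_compl_eq_zero fun x hx => by rw [hφ.eq_zero hx, mul_zero]

lemma IsTestFunction.integrable_mul (hφ : IsTestFunction G φ) {w : Space n → ℂ}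
    (hw : LocallyIntegrableOn w G volume) : Integrable fun x => w x * φ x := by
  have h1 : IntegrableOn w (tsupport φ) volume :=
    hw.integrableOn_compact_subset hφ.support hφ.compact
  have h2 : IntegrableOn (fun x => w x * φ x) (tsupport φ) volume :=
    h1.mul_continuousOn hφ.smooth.continuous.continuousOn hφ.compact
  refine (integrableOn_iff_integrable_of_support_subset ?_).1 h2
  intro x hx
  refine subset_tsupport _ fun h => hx ?_
  simp [h]

lemma HasWeakDeriv.mono {G' : Set (Space n)} {α : Fin n → ℕ} {w g : Space n → ℂ}
    (h : HasWeakDeriv G α w g) (hG : G' ⊆ G) : HasWeakDeriv G' α w g where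
  locallyIntegrable := h.locallyIntegrable.mono_set hG
  locallyIntegrable_deriv := h.locallyIntegrable_deriv.mono_set hG
  integral_eq φ hφ := by
    have := h.integral_eq φ (hφ.mono hG)
    rwa [(hφ.mono hG).setIntegral_mul_eq, ((hφ.mono hG).multiDeriv α).setIntegral_mul_eq,
      ← hφ.setIntegral_mul_eq, ← (hφ.multiDeriv α).setIntegral_mul_eq] at this

lemma locallyIntegrableOn_congr_ae {w w' : Space n → ℂ} (h : w =ᵐ[volume.restrict G] w')
    (hw : LocallyIntegrableOn w G volume) : LocallyIntegrableOn w' G volume := by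
  intro x hx
  obtain ⟨s, hs, hs'⟩ := hw x hx
  refine ⟨s ∩ G, Filter.inter_mem hs self_mem_nhdsWithin, ?_⟩
  refine (hs'.mono_set Set.inter_subset_left).congr ?_
  exact ae_restrict_of_ae_restrict_of_subset Set.inter_subset_right h

lemma HasWeakDeriv.congr {α : Fin n → ℕ} {w g w' g' : Space n → ℂ}
    (h : HasWeakDeriv G α w g) (hw : w =ᵐ[volume.restrict G] w')
    (hg : g =ᵐ[volume.restrict G] g') : HasWeakDeriv G α w' g' where
  locallyIntegrable := locallyIntegrableOn_congr_ae hw h.locallyIntegrable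
  locallyIntegrable_deriv := locallyIntegrableOn_congr_ae hg h.locallyIntegrable_deriv
  integral_eq φ hφ := by
    have e1 : ∫ x in G, w' x * PiecewisePoly.multiDeriv α φ x
        = ∫ x in G, w x * PiecewisePoly.multiDeriv α φ x := by
      refine integral_congr_ae ?_
      filter_upwards [hw] with x hx
      rw [hx]
    have e2 : ∫ x in G, g' x * φ x = ∫ x in G, g x * φ x := by
      refine integral_congr_ae ?_
      filter_upwards [hg] with x hx
      rw [hx]
    rw [e1, e2, h.integral_eq φ hφ]

lemma HasWeakDeriv.add {α : Fin n → ℕ} {w g w' g' : Space n → ℂ}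
    (h : HasWeakDeriv G α w g) (h' : HasWeakDeriv G α w' g') :
    HasWeakDeriv G α (w + w') (g + g') where
  locallyIntegrable := h.locallyIntegrable.add h'.locallyIntegrable
  locallyIntegrable_deriv := h.locallyIntegrable_deriv.add h'.locallyIntegrable_deriv
  integral_eq φ hφ := by
    have i1 := ((hφ.multiDeriv α).integrable_mul h.locallyIntegrable).integrableOn (s := G)
    have i2 := ((hφ.multiDeriv α).integrable_mul h'.locallyIntegrable).integrableOn (s := G)
    have i3 := (hφ.integrable_mul h.locallyIntegrable_deriv).integrableOn (s := G)
    have i4 := (hφ.integrable_mul h'.locallyIntegrable_deriv).integrableOn (s := G)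
    simp only [Pi.add_apply, add_mul]
    rw [integral_add i1 i2, integral_add i3 i4, h.integral_eq φ hφ, h'.integral_eq φ hφ]
    ring

lemma HasWeakDeriv.const_smul {α : Fin n → ℕ} {w g : Space n → ℂ}
    (h : HasWeakDeriv G α w g) (c : ℂ) : HasWeakDeriv G α (c • w) (c • g) where
  locallyIntegrable := h.locallyIntegrable.smul c
  locallyIntegrable_deriv := h.locallyIntegrable_deriv.smul c
  integral_eq φ hφ := by
    simp only [Pi.smul_apply, smul_eq_mul, mul_assoc]
    rw [integral_const_mul, integral_const_mul, h.integral_eq φ hφ]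
    ring

lemma HasWeakDeriv.sub {α : Fin n → ℕ} {w g w' g' : Space n → ℂ}
    (h : HasWeakDeriv G α w g) (h' : HasWeakDeriv G α w' g') :
    HasWeakDeriv G α (w - w') (g - g') := by
  simpa [sub_eq_add_neg] using h.add (h'.const_smul (-1))

/-- Weak derivatives on open sets are unique almost everywhere. -/
lemma HasWeakDeriv.unique (hG : IsOpen G) {α : Fin n → ℕ} {w g g' : Space n → ℂ}
    (h : HasWeakDeriv G α w g) (h' : HasWeakDeriv G α w g') : g =ᵐ[volume.restrict G] g' := by
  have key := hG.ae_eq_zero_of_integral_contDiff_smul_eq_zero (μ := volume) (f := g - g')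
    (h.locallyIntegrable_deriv.sub h'.locallyIntegrable_deriv) ?_
  · rw [Filter.EventuallyEq, ae_restrict_iff' hG.measurableSet]
    filter_upwards [key] with x hx hxG
    exact sub_eq_zero.1 (hx hxG)
  · intro ψ hψ hψc hψs
    have hs : tsupport (fun x => (ψ x : ℂ)) ⊆ tsupport ψ :=
      closure_mono fun x hx h0 => hx (by simp [h0])
    have ht : IsTestFunction G (fun x => (ψ x : ℂ)) :=
      ⟨Complex.ofRealCLM.contDiff.comp hψ, hψc.mono' ((subset_tsupport _).trans hs),
        hs.trans hψs⟩
    have e := (h.integral_eq _ ht).symm.trans (h'.integral_eq _ ht)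
    rw [ht.setIntegral_mul_eq, ht.setIntegral_mul_eq] at e
    have e' := mul_left_cancel₀ (pow_ne_zero _ (by norm_num)) e
    have i1 := ht.integrable_mul h.locallyIntegrable_deriv
    have i2 := ht.integrable_mul h'.locallyIntegrable_deriv
    have : ∀ x, ψ x • (g - g') x = g x * (ψ x : ℂ) - g' x * (ψ x : ℂ) := by
      intro x; simp only [Pi.sub_apply, Complex.real_smul]; ring
    simp_rw [this]
    rw [integral_sub i1 i2, e', sub_self]

lemma weakDerivNorm_eq (hG : IsOpen G) {α : Fin n → ℕ} {w g : Space n → ℂ}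
    (h : HasWeakDeriv G α w g) : weakDerivNorm G α w = eLpNorm g 2 (volume.restrict G) := by
  refine le_antisymm (iInf₂_le g h) (le_iInf₂ fun g' hg' => ?_)
  rw [eLpNorm_congr_ae (h.unique hG hg')]

lemma weakDerivNorm_congr {α : Fin n → ℕ} {w w' : Space n → ℂ}
    (h : w =ᵐ[volume.restrict G] w') : weakDerivNorm G α w = weakDerivNorm G α w' := by
  unfold weakDerivNorm
  congr! 3 with g
  exact ⟨fun H => HasWeakDeriv.congr H h .rfl, fun H => HasWeakDeriv.congr H h.symm .rfl⟩

lemma sobolevSeminorm_sq (G : Set (Space n)) (j : ℕ) (w : Space n → ℂ) :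
    sobolevSeminorm G j w ^ 2
      = ∑ α ∈ Finset.piAntidiag (Finset.univ : Finset (Fin n)) j, weakDerivNorm G α w ^ 2 := by
  rw [sobolevSeminorm, ← ENNReal.rpow_natCast, ← ENNReal.rpow_mul]
  norm_num

/-- The multi-indices of order at most `j`. -/
def multiIndices (n j : ℕ) : Finset (Fin n → ℕ) :=
  (Finset.range (j + 1)).biUnion fun i => Finset.piAntidiag Finset.univ i

lemma mem_multiIndices {j : ℕ} {α : Fin n → ℕ} : α ∈ multiIndices n j ↔ ∑ i, α i ≤ j := by
  simp [multiIndices]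

lemma sobolevNorm_sq (G : Set (Space n)) (j : ℕ) (w : Space n → ℂ) :
    sobolevNorm G j w ^ 2 = ∑ α ∈ multiIndices n j, weakDerivNorm G α w ^ 2 := by
  rw [sobolevNorm, ← ENNReal.rpow_natCast, ← ENNReal.rpow_mul]
  norm_num
  simp_rw [sobolevSeminorm_sq]
  rw [multiIndices, Finset.sum_biUnion]
  intro a _ b _ hab
  refine Finset.disjoint_left.2 fun α ha hb => hab ?_
  rw [← (Finset.mem_piAntidiag.1 ha).1, (Finset.mem_piAntidiag.1 hb).1]


lemma sobolevNorm_congr {j : ℕ} {w w' : Space n → ℂ} (h : w =ᵐ[volume.restrict G] w') :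
    sobolevNorm G j w = sobolevNorm G j w' := by
  simp only [sobolevNorm, sobolevSeminorm, weakDerivNorm_congr h]

/-- The derivative `∂_{n}^{α_n} ⋯ ∂_1^{α_1} f`, with the partial derivatives applied in the order
opposite to that of `multiDeriv`: it is what integration by parts produces when the factors of
`multiDeriv α` are moved from the test function to `f` one after the other. -/
noncomputable def revMultiDeriv (α : Fin n → ℕ) (f : Space n → ℂ) : Space n → ℂ :=
  (List.finRange n).foldl (fun ψ i => (partialDeriv i)^[α i] ψ) f

lemma contDiff_foldl {f : Space n → ℂ} (hf : ContDiff ℝ ∞ f) (α : Fin n → ℕ)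
    (l : List (Fin n)) :
    ContDiff ℝ ∞ (l.foldl (fun ψ i => (partialDeriv i)^[α i] ψ) f) := by
  induction l generalizing f with
  | nil => exact hf
  | cons i l ih => exact ih (contDiff_partialDeriv_iterate hf i _)

lemma contDiff_revMultiDeriv {f : Space n → ℂ} (hf : ContDiff ℝ ∞ f) (α : Fin n → ℕ) :
    ContDiff ℝ ∞ (revMultiDeriv α f) :=
  contDiff_foldl hf α _

lemma integral_mul_partialDeriv {f : Space n → ℂ} (hf : ContDiff ℝ ∞ f)
    (hφ : IsTestFunction G φ) (i : Fin n) :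
    ∫ x, f x * partialDeriv i φ x = - ∫ x, partialDeriv i f x * φ x := by
  have hloc : ∀ {w : Space n → ℂ}, ContDiff ℝ ∞ w → LocallyIntegrableOn w G volume :=
    fun hw => (hw.continuous.locallyIntegrable).locallyIntegrableOn G
  exact integral_mul_fderiv_eq_neg_fderiv_mul_of_integrable
    (hφ.integrable_mul (hloc (contDiff_partialDeriv hf i)))
    ((hφ.partialDeriv i).integrable_mul (hloc hf)) (hφ.integrable_mul (hloc hf))
    (fun x _ => hf.differentiable (by simp) x)
    (fun x _ => hφ.smooth.differentiable (by simp) x)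

lemma integral_mul_partialDeriv_iterate {f : Space n → ℂ} (hf : ContDiff ℝ ∞ f)
    (hφ : IsTestFunction G φ) (i : Fin n) (k : ℕ) :
    ∫ x, f x * (partialDeriv i)^[k] φ x = (-1) ^ k * ∫ x, (partialDeriv i)^[k] f x * φ x := by
  induction k generalizing f with
  | zero => simp
  | succ k ih =>
    rw [Function.iterate_succ_apply', integral_mul_partialDeriv hf (hφ.iterate i k),
      ih (contDiff_partialDeriv hf i), ← Function.iterate_succ_apply, pow_succ]
    ring

lemma integral_mul_foldr {f : Space n → ℂ} (hf : ContDiff ℝ ∞ f)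
    (hφ : IsTestFunction G φ) (α : Fin n → ℕ) (l : List (Fin n)) :
    ∫ x, f x * l.foldr (fun i ψ => (partialDeriv i)^[α i] ψ) φ x
      = (-1) ^ (l.map α).sum
        * ∫ x, l.foldl (fun ψ i => (partialDeriv i)^[α i] ψ) f x * φ x := by
  induction l generalizing f with
  | nil => simp
  | cons i l ih =>
    rw [List.foldr_cons, integral_mul_partialDeriv_iterate hf (hφ.foldr α l),
      ih (contDiff_partialDeriv_iterate hf i _), List.foldl_cons, List.map_cons, List.sum_cons,
      pow_add, mul_assoc]

lemma hasWeakDeriv_of_contDiff {f : Space n → ℂ} (hf : ContDiff ℝ ∞ f) (α : Fin n → ℕ)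
    (G : Set (Space n)) : HasWeakDeriv G α f (revMultiDeriv α f) where
  locallyIntegrable := hf.continuous.locallyIntegrable.locallyIntegrableOn G
  locallyIntegrable_deriv :=
    (contDiff_revMultiDeriv hf α).continuous.locallyIntegrable.locallyIntegrableOn G
  integral_eq φ hφ := by
    rw [(hφ.multiDeriv α).setIntegral_mul_eq, hφ.setIntegral_mul_eq, multiDeriv,
      integral_mul_foldr hf hφ, Fin.sum_univ_def, revMultiDeriv]

end WeakDerivatives

/-! ### Square integrable functions and their Fourier transforms -/

section Fourier

open FourierTransform SchwartzMap Complex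
open scoped Real LineDeriv

variable {n : ℕ}

/-- The exponent `2πi⟨x, ξ⟩` of the plane wave. -/
noncomputable def phase (x ξ : Space n) : ℂ := (2 * π * inner ℝ x ξ : ℝ) * I

/-- The plane wave `e^{2πi⟨x, ξ⟩}`. -/
noncomputable def wave (x ξ : Space n) : ℂ := cexp (phase x ξ)

lemma norm_wave (x ξ : Space n) : ‖wave x ξ‖ = 1 := norm_exp_ofReal_mul_I _

lemma wave_add (x y ξ : Space n) : wave (x + y) ξ = wave x ξ * wave y ξ := by
  rw [wave, wave, wave, ← Complex.exp_add, phase, phase, phase, inner_add_left]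
  congr 1
  push_cast
  ring

lemma wave_comm (x ξ : Space n) : wave x ξ = wave ξ x := by
  rw [wave, wave, phase, phase, real_inner_comm]

lemma continuous_wave : Continuous fun z : Space n × Space n => wave z.1 z.2 := by
  unfold wave phase
  fun_prop

lemma fourierInv_eq_integral_wave (f : Space n → ℂ) (x : Space n) :
    𝓕⁻ f x = ∫ ξ, wave x ξ * f ξ := by
  rw [Real.fourierInv_eq']
  simp only [wave, phase, smul_eq_mul, real_inner_comm]

/-- `W` and `w` are square integrable and `w` is the inverse Fourier transform of `W`, as tested
against Schwartz functions. -/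
structure IsSpectrum (W w : Space n → ℂ) : Prop where
  memLp_spectrum : MemLp W 2 volume
  memLp : MemLp w 2 volume
  integral_eq : ∀ φ : 𝓢(Space n, ℂ), ∫ x, φ x * w x = ∫ ξ, (𝓕⁻ φ) ξ * W ξ

lemma integrable_schwartz_mul (φ : 𝓢(Space n, ℂ)) {w : Space n → ℂ} (hw : MemLp w 2 volume) :
    Integrable fun x => φ x * w x :=
  (φ.memLp 2 volume).integrable_mul hw

lemma isSpectrum_fourierInv (f : Lp ℂ 2 (volume : Measure (Space n))) :
    IsSpectrum f (𝓕⁻ f : Lp ℂ 2 (volume : Measure (Space n))) where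
  memLp_spectrum := Lp.memLp f
  memLp := Lp.memLp _
  integral_eq φ := by
    have h := congrArg (fun T => T φ) (Lp.fourierInv_toTemperedDistribution_eq f)
    simp only [TemperedDistribution.fourierInv_apply, Lp.toTemperedDistribution_apply,
      smul_eq_mul] at h
    exact h.symm

lemma ae_eq_of_integral_schwartz {w w' : Space n → ℂ} (hw : LocallyIntegrable w)
    (hw' : LocallyIntegrable w')
    (h : ∀ φ : 𝓢(Space n, ℂ), ∫ x, φ x * w x = ∫ x, φ x * w' x) : w =ᵐ[volume] w' := by
  refine ae_eq_of_integral_contDiff_smul_eq hw hw' fun g hg hgc => ?_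
  have h1 : HasCompactSupport (fun x => (g x : ℂ)) :=
    hgc.comp_left (g := fun r : ℝ => (r : ℂ)) Complex.ofReal_zero
  have h2 : ContDiff ℝ ∞ (fun x => (g x : ℂ)) := Complex.ofRealCLM.contDiff.comp hg
  simpa using h (h1.toSchwartzMap h2)

lemma locallyIntegrable_of_memLp_two {w : Space n → ℂ} (hw : MemLp w 2 volume) :
    LocallyIntegrable w := hw.locallyIntegrable (by norm_num)

lemma IsSpectrum.unique {W w w' : Space n → ℂ} (h : IsSpectrum W w) (h' : IsSpectrum W w') :
    w =ᵐ[volume] w' :=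
  ae_eq_of_integral_schwartz (locallyIntegrable_of_memLp_two h.memLp)
    (locallyIntegrable_of_memLp_two h'.memLp)
    fun φ => (h.integral_eq φ).trans (h'.integral_eq φ).symm

lemma IsSpectrum.congr {W W' w w' : Space n → ℂ} (h : IsSpectrum W w) (hW : W =ᵐ[volume] W')
    (hw : w =ᵐ[volume] w') : IsSpectrum W' w' where
  memLp_spectrum := (memLp_congr_ae hW).1 h.memLp_spectrum
  memLp := (memLp_congr_ae hw).1 h.memLp
  integral_eq φ := by
    have e1 : ∫ x, φ x * w' x = ∫ x, φ x * w x :=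
      integral_congr_ae (by filter_upwards [hw] with x hx; rw [hx])
    have e2 : ∫ x, (𝓕⁻ φ) x * W' x = ∫ x, (𝓕⁻ φ) x * W x :=
      integral_congr_ae (by filter_upwards [hW] with x hx; rw [hx])
    rw [e1, e2, h.integral_eq]

lemma exists_isSpectrum {W : Space n → ℂ} (hW : MemLp W 2 volume) :
    ∃ w, StronglyMeasurable w ∧ IsSpectrum W w :=
  ⟨_, Lp.stronglyMeasurable _,
    (isSpectrum_fourierInv (hW.toLp W)).congr hW.coeFn_toLp .rfl⟩

/-- Plancherel's identity. -/
lemma IsSpectrum.eLpNorm_eq {W w : Space n → ℂ} (h : IsSpectrum W w) :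
    eLpNorm w 2 volume = eLpNorm W 2 volume := by
  have h1 := (isSpectrum_fourierInv (h.memLp_spectrum.toLp W)).congr
    h.memLp_spectrum.coeFn_toLp .rfl
  rw [eLpNorm_congr_ae (h.unique h1), ← Lp.enorm_def,
    ← eLpNorm_congr_ae h.memLp_spectrum.coeFn_toLp, ← Lp.enorm_def]
  have : ‖(𝓕⁻ (h.memLp_spectrum.toLp W) : Lp ℂ 2 (volume : Measure (Space n)))‖
      = ‖h.memLp_spectrum.toLp W‖ :=
    (Lp.fourierTransformₗᵢ (Space n) ℂ).symm.norm_map _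
  rw [← ofReal_norm, ← ofReal_norm, this]

lemma IsSpectrum.sub {W w W' w' : Space n → ℂ} (h : IsSpectrum W w) (h' : IsSpectrum W' w') :
    IsSpectrum (W - W') (w - w') where
  memLp_spectrum := h.memLp_spectrum.sub h'.memLp_spectrum
  memLp := h.memLp.sub h'.memLp
  integral_eq φ := by
    simp only [Pi.sub_apply, mul_sub]
    rw [integral_sub (integrable_schwartz_mul φ h.memLp) (integrable_schwartz_mul φ h'.memLp),
      integral_sub (integrable_schwartz_mul _ h.memLp_spectrum)
        (integrable_schwartz_mul _ h'.memLp_spectrum), h.integral_eq, h'.integral_eq]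

lemma fourierInv_compSubConst (φ : 𝓢(Space n, ℂ)) (y ξ : Space n) :
    (𝓕⁻ (φ.compSubConstCLM ℂ y)) ξ = wave y ξ * (𝓕⁻ φ) ξ := by
  rw [SchwartzMap.fourierInv_coe, SchwartzMap.fourierInv_coe, fourierInv_eq_integral_wave,
    fourierInv_eq_integral_wave, ← integral_const_mul,
    ← integral_add_right_eq_self (fun x => wave ξ x * _) y]
  congr 1
  ext x
  rw [SchwartzMap.compSubConstCLM_apply, add_sub_cancel_right, wave_comm ξ, wave_add,
    wave_comm x]
  ring

lemma memLp_wave_mul {W : Space n → ℂ} (hW : MemLp W 2 volume) (y : Space n) :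
    MemLp (fun ξ => wave y ξ * W ξ) 2 volume := by
  refine hW.of_le (AEStronglyMeasurable.mul ?_ hW.1) (.of_forall fun ξ => ?_)
  · exact (continuous_wave.comp (by fun_prop : Continuous fun ξ : Space n => (y, ξ))
      ).aestronglyMeasurable
  · rw [norm_mul, norm_wave, one_mul]

lemma IsSpectrum.translate {W w : Space n → ℂ} (h : IsSpectrum W w) (y : Space n) :
    IsSpectrum (fun ξ => wave y ξ * W ξ) (fun x => w (x + y)) where
  memLp_spectrum := memLp_wave_mul h.memLp_spectrum y
  memLp := h.memLp.comp_measurePreserving (measurePreserving_add_right volume y)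
  integral_eq φ := by
    have h1 := h.integral_eq (φ.compSubConstCLM ℂ y)
    rw [← integral_add_right_eq_self _ y] at h1
    simp only [SchwartzMap.compSubConstCLM_apply, add_sub_cancel_right,
      fourierInv_compSubConst] at h1
    rw [h1]
    congr 1
    ext ξ
    ring

lemma integral_schwartz_mul_integral_wave {W : Space n → ℂ} (hW : Integrable W)
    (φ : 𝓢(Space n, ℂ)) :
    ∫ x, φ x * ∫ ξ, wave x ξ * W ξ = ∫ ξ, (𝓕⁻ φ) ξ * W ξ := by
  have h := VectorFourier.integral_fourierIntegral_smul_eq_flip (e := Real.fourierChar)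
    (μ := (volume : Measure (Space n))) (ν := (volume : Measure (Space n)))
    (L := -innerₗ (Space n)) (f := φ) (g := W)
    Real.continuous_fourierChar (by simp only [LinearMap.neg_apply, innerₗ_apply_apply]; fun_prop)
    φ.integrable hW
  have hflip : (-innerₗ (Space n)).flip = -innerₗ (Space n) := by
    ext x y
    simp [real_inner_comm]
  rw [hflip] at h
  simp only [smul_eq_mul] at h
  rw [SchwartzMap.fourierInv_coe]
  simp_rw [← fourierInv_eq_integral_wave]
  exact h.symm

lemma continuous_integral_wave {W : Space n → ℂ} (hW : Integrable W) :
    Continuous fun x => ∫ ξ, wave x ξ * W ξ := by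
  refine continuous_of_dominated (bound := fun ξ => ‖W ξ‖) (fun x => ?_) (fun x => ?_)
    hW.norm (.of_forall fun ξ => ?_)
  · exact ((continuous_wave.comp (by fun_prop : Continuous fun ξ : Space n => (x, ξ))
      ).aestronglyMeasurable).mul hW.1
  · exact .of_forall fun ξ => by rw [norm_mul, norm_wave, one_mul]
  · exact (continuous_wave.comp (by fun_prop : Continuous fun x : Space n => (x, ξ))).mul
      continuous_const

lemma isSpectrum_integral_wave {W : Space n → ℂ} (h1 : Integrable W) (h2 : MemLp W 2 volume) :
    IsSpectrum W (fun x => ∫ ξ, wave x ξ * W ξ) := by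
  obtain ⟨w, -, hw⟩ := exists_isSpectrum h2
  refine hw.congr .rfl ?_
  refine ae_eq_of_integral_schwartz (locallyIntegrable_of_memLp_two hw.memLp)
    (continuous_integral_wave h1).locallyIntegrable fun φ => ?_
  rw [hw.integral_eq, integral_schwartz_mul_integral_wave h1]

/-! ### Weak derivatives on the Fourier side -/

/-- The Fourier symbol `(2πiξ)^α` of the derivative `D^α`. -/
noncomputable def symbol (α : Fin n → ℕ) (ξ : Space n) : ℂ := ∏ i, (2 * π * I * ξ i) ^ α i

lemma continuous_symbol (α : Fin n → ℕ) : Continuous (symbol α : Space n → ℂ) := by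
  unfold symbol
  fun_prop

lemma norm_symbol_le (α : Fin n → ℕ) (ξ : Space n) :
    ‖symbol α ξ‖ ≤ (2 * π * ‖ξ‖) ^ ∑ i, α i := by
  rw [symbol, norm_prod, ← Finset.prod_pow_eq_pow_sum]
  refine Finset.prod_le_prod (fun i _ => norm_nonneg _) fun i _ => ?_
  rw [norm_pow]
  refine pow_le_pow_left₀ (norm_nonneg _) ?_ _
  have : ‖ξ i‖ ≤ ‖ξ‖ := PiLp.norm_apply_le ξ i
  simp only [norm_mul, Complex.norm_ofNat, norm_real, norm_I, mul_one, Real.norm_eq_abs,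
    abs_of_pos Real.pi_pos]
  gcongr
  simpa using this

lemma exists_schwartz_iterate (φ : 𝓢(Space n, ℂ)) (i : Fin n) (k : ℕ) :
    ∃ ψ : 𝓢(Space n, ℂ), ⇑ψ = (partialDeriv i)^[k] φ ∧
      ∀ ξ, (𝓕⁻ ψ) ξ = (-(2 * π * I * ξ i)) ^ k * (𝓕⁻ φ) ξ := by
  induction k with
  | zero => exact ⟨φ, rfl, by simp⟩
  | succ k ih =>
    obtain ⟨ψ, h1, h2⟩ := ih
    refine ⟨∂_{EuclideanSpace.single i (1 : ℝ)} ψ, ?_, fun ξ => ?_⟩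
    · ext x
      rw [Function.iterate_succ_apply', ← h1, SchwartzMap.lineDerivOp_apply_eq_fderiv]
      rfl
    · have hg : (fun x : Space n =>
          inner ℝ x (EuclideanSpace.single i (1 : ℝ))).HasTemperateGrowth := by
        fun_prop
      rw [SchwartzMap.fourierInv_lineDerivOp_eq, smul_apply,
        SchwartzMap.smulLeftCLM_apply_apply hg, h2, pow_succ]
      simp [EuclideanSpace.inner_single_right]
      ring

lemma exists_schwartz_multiDeriv {φ : Space n → ℂ} {G : Set (Space n)}
    (hφ : IsTestFunction G φ) (α : Fin n → ℕ) :
    ∃ φ' ψ : 𝓢(Space n, ℂ), ⇑φ' = φ ∧ ⇑ψ = multiDeriv α φ ∧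
      ∀ ξ, (𝓕⁻ ψ) ξ = (-1) ^ (∑ i, α i) * symbol α ξ * (𝓕⁻ φ') ξ := by
  refine ⟨hφ.compact.toSchwartzMap hφ.smooth, ?_⟩
  have key : ∀ l : List (Fin n), ∃ ψ : 𝓢(Space n, ℂ),
      ⇑ψ = l.foldr (fun i ψ => (partialDeriv i)^[α i] ψ) φ ∧
      ∀ ξ, (𝓕⁻ ψ) ξ = (l.map fun i => (-(2 * π * I * ξ i)) ^ α i).prod
        * (𝓕⁻ (hφ.compact.toSchwartzMap hφ.smooth)) ξ := by
    intro l
    induction l with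
    | nil => exact ⟨hφ.compact.toSchwartzMap hφ.smooth, rfl, by simp⟩
    | cons i l ih =>
      obtain ⟨ψ, h1, h2⟩ := ih
      obtain ⟨ψ', h3, h4⟩ := exists_schwartz_iterate ψ i (α i)
      refine ⟨ψ', by rw [h3, h1]; rfl, fun ξ => ?_⟩
      rw [h4, h2, List.map_cons, List.prod_cons, ← mul_assoc (_ ^ _)]
  obtain ⟨ψ, h1, h2⟩ := key (List.finRange n)
  refine ⟨ψ, rfl, h1, fun ξ => ?_⟩
  rw [h2, ← Fin.prod_univ_def, symbol, ← Finset.prod_pow_eq_pow_sum, ← Finset.prod_mul_distrib]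
  congr 1
  refine Finset.prod_congr rfl fun i _ => ?_
  rw [← mul_pow]
  ring

lemma IsSpectrum.hasWeakDeriv {W w g : Space n → ℂ} (h : IsSpectrum W w) {α : Fin n → ℕ}
    (hg : IsSpectrum (fun ξ => symbol α ξ * W ξ) g) : HasWeakDeriv Set.univ α w g where
  locallyIntegrable := (locallyIntegrable_of_memLp_two h.memLp).locallyIntegrableOn _
  locallyIntegrable_deriv := (locallyIntegrable_of_memLp_two hg.memLp).locallyIntegrableOn _
  integral_eq φ hφ := by
    obtain ⟨φ', ψ, h1, h2, h3⟩ := exists_schwartz_multiDeriv hφ α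
    have e1 := h.integral_eq ψ
    have e2 := hg.integral_eq φ'
    rw [hφ.setIntegral_mul_eq, (hφ.multiDeriv α).setIntegral_mul_eq]
    simp_rw [← h2, ← h1, mul_comm (w _), mul_comm (g _)]
    rw [e1, e2, ← integral_const_mul]
    congr 1
    ext ξ
    rw [h3]
    ring

/-- The Fourier transform `W` of a function in `H^m`, with `|ξ|^k W` square integrable for
`k ≤ m`. -/
lemma MemH.exists_isSpectrum {m : ℕ} {U : Space n → ℂ} (h : MemH m U) :
    ∃ W, StronglyMeasurable W ∧ IsSpectrum W U ∧
      ∀ k ≤ m, MemLp (fun ξ => (‖ξ‖ ^ k : ℝ) * W ξ) 2 volume := by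
  obtain ⟨hU, hS⟩ := h
  set f : Lp ℂ 2 (volume : Measure (Space n)) := 𝓕 (hU.toLp U) with hf
  have hW : IsSpectrum f U := by
    refine (isSpectrum_fourierInv f).congr .rfl ?_
    rw [hf, fourierInv_fourier_eq]
    exact hU.coeFn_toLp
  refine ⟨f, Lp.stronglyMeasurable f, hW, ?_⟩
  obtain ⟨f', hf'⟩ := TemperedDistribution.memSobolev_iff_exists_smulLeftCLM_fourier.1 hS
  rw [Lp.fourier_toTemperedDistribution_eq] at hf'
  set q : Space n → ℝ := fun ξ => (1 + ‖ξ‖ ^ 2) ^ ((m : ℝ) / 2) with hq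
  have hqg : (fun ξ => (q ξ : ℂ)).HasTemperateGrowth := by
    rw [hq]; fun_prop
  have hqc : Continuous fun ξ => (q ξ : ℂ) := hqg.1.continuous
  have hqf : (fun ξ => (q ξ : ℂ) * f ξ) =ᵐ[volume] f' := by
    refine ae_eq_of_integral_schwartz ?_ (locallyIntegrable_of_memLp_two (Lp.memLp f'))
      fun φ => ?_
    · rw [← locallyIntegrableOn_univ]
      exact ((locallyIntegrable_of_memLp_two (Lp.memLp f)).locallyIntegrableOn _).continuousOn_mul
        hqc.continuousOn isOpen_univ.isLocallyClosed
    · have := congrArg (fun T => T φ) hf'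
      simp only [TemperedDistribution.smulLeftCLM_apply_apply, Lp.toTemperedDistribution_apply,
        smul_eq_mul] at this
      rw [← this]
      congr 1
      ext ξ
      rw [SchwartzMap.smulLeftCLM_apply_apply hqg]
      simp only [smul_eq_mul]
      ring
  have hqm : MemLp (fun ξ => (q ξ : ℂ) * f ξ) 2 volume := (memLp_congr_ae hqf).2 (Lp.memLp f')
  intro k hk
  refine hqm.of_le (AEStronglyMeasurable.mul (by fun_prop) (Lp.aestronglyMeasurable f))
    (.of_forall fun ξ => ?_)
  rw [norm_mul, norm_mul]
  gcongr
  have h1 : ‖ξ‖ ≤ (1 + ‖ξ‖ ^ 2) ^ ((1 : ℝ) / 2) := by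
    rw [← Real.sqrt_eq_rpow]
    exact Real.le_sqrt_of_sq_le (by linarith)
  have h2 : 1 ≤ (1 + ‖ξ‖ ^ 2) ^ ((1 : ℝ) / 2) :=
    Real.one_le_rpow (by nlinarith [sq_nonneg ‖ξ‖]) (by norm_num)
  have h3 : q ξ = ((1 + ‖ξ‖ ^ 2) ^ ((1 : ℝ) / 2)) ^ m := by
    rw [hq, ← Real.rpow_mul_natCast (by positivity)]
    ring_nf
  rw [norm_real, norm_real, Real.norm_of_nonneg (by positivity),
    Real.norm_of_nonneg (by rw [hq]; positivity), h3]
  calc ‖ξ‖ ^ k ≤ ((1 + ‖ξ‖ ^ 2) ^ ((1 : ℝ) / 2)) ^ k := by gcongr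
    _ ≤ _ := pow_le_pow_right₀ h2 hk

lemma memLp_symbol_mul {m : ℕ} {W : Space n → ℂ} (hW : StronglyMeasurable W)
    (h : ∀ k ≤ m, MemLp (fun ξ => (‖ξ‖ ^ k : ℝ) * W ξ) 2 volume) {α : Fin n → ℕ}
    (hα : ∑ i, α i ≤ m) : MemLp (fun ξ => symbol α ξ * W ξ) 2 volume := by
  refine (h _ hα).of_le_mul (c := (2 * π) ^ ∑ i, α i)
    ((continuous_symbol α).aestronglyMeasurable.mul hW.aestronglyMeasurable)
    (.of_forall fun ξ => ?_)
  rw [norm_mul, norm_mul, ← mul_assoc, norm_real, Real.norm_of_nonneg (by positivity), ← mul_pow]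
  gcongr
  exact norm_symbol_le α ξ

end Fourier

/-! ### Local Taylor polynomials of band-limited functions -/

section BandTaylor

open Complex
open scoped Real

variable {n : ℕ}

lemma continuous_phase : Continuous fun z : Space n × Space n => phase z.1 z.2 := by
  unfold phase
  fun_prop

lemma phase_add (x y ξ : Space n) : phase (x + y) ξ = phase x ξ + phase y ξ := by
  rw [phase, phase, phase, inner_add_left]
  push_cast
  ring

lemma phase_smul (s : ℝ) (x ξ : Space n) : phase (s • x) ξ = s * phase x ξ := by
  rw [phase, phase, real_inner_smul_left]
  push_cast
  ring

lemma phase_single (i : Fin n) (ξ : Space n) :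
    phase (EuclideanSpace.single i 1) ξ = 2 * π * I * ξ i := by
  rw [phase, EuclideanSpace.inner_single_left]
  simp
  ring

lemma phase_eq_sum (x ξ : Space n) : phase x ξ = ∑ i, (2 * π * I * ξ i) * x i := by
  rw [phase, PiLp.inner_apply]
  push_cast
  rw [Finset.mul_sum, Finset.sum_mul]
  refine Finset.sum_congr rfl fun i _ => ?_
  simp
  ring

lemma norm_phase_le (x ξ : Space n) : ‖phase x ξ‖ ≤ 2 * π * (‖x‖ * ‖ξ‖) := by
  rw [phase, norm_mul, norm_I, mul_one, norm_real, norm_mul,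
    Real.norm_of_nonneg (by positivity : 0 ≤ 2 * π)]
  gcongr
  exact norm_inner_le_norm x ξ

/-- The sum of the first `q` terms of the exponential series. -/
noncomputable def expSum (q : ℕ) (z : ℂ) : ℂ := ∑ k ∈ Finset.range q, z ^ k / k.factorial

lemma expSum_zero (z : ℂ) : expSum 0 z = 0 := by simp [expSum]

lemma expSum_succ (q : ℕ) (z : ℂ) : expSum (q + 1) z = expSum q z + z ^ q / q.factorial :=
  Finset.sum_range_succ _ _

lemma continuous_expSum (q : ℕ) : Continuous (expSum q) := by
  unfold expSum
  fun_prop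

lemma hasDerivAt_expSum (q : ℕ) (z : ℂ) : HasDerivAt (expSum q) (expSum (q - 1) z) z := by
  cases q with
  | zero => exact (hasDerivAt_const z (0 : ℂ)).congr_of_eventuallyEq (.of_forall expSum_zero)
      |>.congr_deriv (expSum_zero z).symm
  | succ q =>
    rw [Nat.add_sub_cancel]
    induction q with
    | zero =>
      rw [expSum_zero]
      exact (hasDerivAt_const z (1 : ℂ)).congr_of_eventuallyEq
        (.of_forall fun w => by simp [expSum])
    | succ q ih =>
      have h := ih.add ((hasDerivAt_pow (q + 1) z).div_const ((q + 1).factorial : ℂ))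
      rw [expSum_succ]
      refine (h.congr_of_eventuallyEq (.of_forall fun w => expSum_succ (q + 1) w)).congr_deriv ?_
      rw [Nat.factorial_succ, Nat.add_sub_cancel]
      push_cast
      have h1 : ((q : ℂ) + 1) ≠ 0 := Nat.cast_add_one_ne_zero q
      have h2 : (q.factorial : ℂ) ≠ 0 := Nat.cast_ne_zero.2 q.factorial_ne_zero
      field_simp

/-- `V` is square integrable and vanishes at frequencies larger than `R`. -/
structure IsBand (R : ℝ) (V : Space n → ℂ) : Prop where
  stronglyMeasurable : StronglyMeasurable V
  memLp : MemLp V 2 volume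
  eq_zero : ∀ ξ, R < ‖ξ‖ → V ξ = 0

lemma IsBand.integrable {R : ℝ} {V : Space n → ℂ} (h : IsBand R V) : Integrable V := by
  refine (integrableOn_iff_integrable_of_support_subset (s := Metric.closedBall 0 R) ?_).1 ?_
  · intro ξ hξ
    rw [mem_closedBall_zero_iff]
    exact not_lt.1 fun h' => hξ (h.eq_zero ξ h')
  · have : IsFiniteMeasure (volume.restrict (Metric.closedBall (0 : Space n) R)) :=
      ⟨by simpa using (isCompact_closedBall (0 : Space n) R).measure_lt_top⟩
    exact (h.memLp.restrict _).integrable (by norm_num)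

lemma IsBand.mul {R : ℝ} {V f : Space n → ℂ} (h : IsBand R V) (hf : Continuous f) :
    IsBand R (fun ξ => f ξ * V ξ) where
  stronglyMeasurable := hf.stronglyMeasurable.mul h.stronglyMeasurable
  memLp := by
    obtain ⟨C, hC⟩ := (isCompact_closedBall (0 : Space n) R).exists_bound_of_continuousOn
      hf.continuousOn
    refine h.memLp.of_le_mul (c := C)
      (hf.stronglyMeasurable.mul h.stronglyMeasurable).aestronglyMeasurable
      (.of_forall fun ξ => ?_)
    by_cases hξ : R < ‖ξ‖
    · simp [h.eq_zero ξ hξ]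
    · rw [norm_mul]
      gcongr
      exact hC ξ (by simpa using hξ)
  eq_zero ξ hξ := by rw [h.eq_zero ξ hξ, mul_zero]

/-- The Taylor polynomial with `q` terms, around `b` and evaluated at `x`, of the function
`x ↦ ∫ e^{2πi⟨x, ξ⟩} V(ξ) dξ`. -/
noncomputable def bandTaylor (V : Space n → ℂ) (q : ℕ) (b x : Space n) : ℂ :=
  ∫ ξ, wave b ξ * expSum q (phase (x - b) ξ) * V ξ

lemma continuous_wave_right (b : Space n) : Continuous (wave b) :=
  continuous_wave.comp (by fun_prop : Continuous fun ξ : Space n => (b, ξ))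

lemma continuous_phase_right (b : Space n) : Continuous (phase b) :=
  continuous_phase.comp (by fun_prop : Continuous fun ξ : Space n => (b, ξ))

lemma stronglyMeasurable_bandTaylor {V : Space n → ℂ} (hV : StronglyMeasurable V) (q : ℕ) :
    StronglyMeasurable fun z : Space n × Space n => bandTaylor V q z.1 z.2 := by
  refine StronglyMeasurable.integral_prod_right
    (f := fun (z : Space n × Space n) ξ => wave z.1 ξ * expSum q (phase (z.2 - z.1) ξ) * V ξ) ?_
  refine StronglyMeasurable.mul (Continuous.stronglyMeasurable ?_)
    (hV.comp_measurable measurable_snd)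
  have h3 : Continuous fun z : (Space n × Space n) × Space n => wave z.1.1 z.2 := by
    unfold wave phase; fun_prop
  have h4 : Continuous fun z : (Space n × Space n) × Space n => phase (z.1.2 - z.1.1) z.2 := by
    unfold phase; fun_prop
  exact h3.mul ((continuous_expSum q).comp h4)

/-- The function on `ℝⁿ` given by a polynomial. -/
noncomputable def polyFun (P : MvPolynomial (Fin n) ℂ) : Space n → ℂ :=
  fun x => MvPolynomial.eval (fun i => (x i : ℂ)) P

/-- `bandTaylor V q b` is a polynomial: the coefficients come from the multinomial theorem. -/
lemma exists_polyFun_eq_bandTaylor {R : ℝ} {V : Space n → ℂ} (hV : IsBand R V) {q p : ℕ}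
    (hq : q ≤ p + 1) (b : Space n) :
    ∃ P : MvPolynomial (Fin n) ℂ, P.totalDegree ≤ p ∧
      polyFun P = bandTaylor V q b := by
  classical
  refine ⟨∑ k ∈ Finset.range q, ∑ γ ∈ Finset.piAntidiag (Finset.univ : Finset (Fin n)) k,
    MvPolynomial.C ((Nat.multinomial Finset.univ γ : ℂ) / k.factorial
      * ∫ ξ, wave b ξ * (symbol γ ξ * V ξ)) *
    ∏ i, (MvPolynomial.X i - MvPolynomial.C (b i : ℂ)) ^ γ i, ?_, funext fun x => ?_⟩
  · refine MvPolynomial.totalDegree_finsetSum_le fun k hk => ?_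
    refine MvPolynomial.totalDegree_finsetSum_le fun γ hγ => ?_
    refine (MvPolynomial.totalDegree_mul _ _).trans ?_
    rw [MvPolynomial.totalDegree_C, zero_add]
    refine (MvPolynomial.totalDegree_finsetProd _ _).trans ?_
    refine (Finset.sum_le_sum fun i _ => (MvPolynomial.totalDegree_pow _ _).trans
      (Nat.mul_le_mul_left _ ((MvPolynomial.totalDegree_sub_C_le _ _).trans
        (MvPolynomial.totalDegree_X i).le))).trans ?_
    simp only [mul_one]
    rw [(Finset.mem_piAntidiag.1 hγ).1]
    have := Finset.mem_range.1 hk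
    omega
  · simp only [polyFun, map_sum, map_mul, map_prod, map_pow, map_sub, MvPolynomial.eval_C,
      MvPolynomial.eval_X]
    have hint : ∀ γ : Fin n → ℕ, Integrable fun ξ => wave b ξ * (symbol γ ξ * V ξ) :=
      fun γ => ((hV.mul (continuous_symbol γ)).mul (continuous_wave_right b)).integrable
    simp_rw [mul_right_comm _ (∫ ξ, _) _, ← integral_const_mul]
    rw [bandTaylor]
    have e : ∀ ξ, wave b ξ * expSum q (phase (x - b) ξ) * V ξ
        = ∑ k ∈ Finset.range q, ∑ γ ∈ Finset.piAntidiag (Finset.univ : Finset (Fin n)) k,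
          (Nat.multinomial Finset.univ γ : ℂ) / k.factorial
            * (∏ i, ((x i : ℂ) - (b i : ℂ)) ^ γ i) * (wave b ξ * (symbol γ ξ * V ξ)) := by
      intro ξ
      rw [expSum, Finset.mul_sum, Finset.sum_mul]
      refine Finset.sum_congr rfl fun k _ => ?_
      rw [phase_eq_sum, Finset.sum_pow_eq_sum_piAntidiag, Finset.sum_div, Finset.mul_sum,
        Finset.sum_mul]
      refine Finset.sum_congr rfl fun γ _ => ?_
      simp_rw [mul_pow, Finset.prod_mul_distrib]
      rw [symbol]
      simp only [PiLp.sub_apply, ofReal_sub, mul_pow, Finset.prod_mul_distrib]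
      ring
    simp_rw [e]
    rw [integral_finsetSum]
    · refine Finset.sum_congr rfl fun k _ => ?_
      rw [integral_finsetSum]
      exact fun γ _ => (hint γ).const_mul _
    · exact fun k _ => integrable_finsetSum _ fun γ _ => (hint γ).const_mul _

lemma contDiff_polyFun (P : MvPolynomial (Fin n) ℂ) : ContDiff ℝ ∞ (polyFun P) := by
  unfold polyFun
  induction P using MvPolynomial.induction_on with
  | C a => simpa using contDiff_const
  | add P Q hP hQ => simpa using hP.add hQ
  | mul_X P i hP =>
    simp only [map_mul, MvPolynomial.eval_X]
    exact hP.mul (Complex.ofRealCLM.contDiff.comp (by fun_prop))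

lemma contDiff_bandTaylor {R : ℝ} {V : Space n → ℂ} (hV : IsBand R V) (q : ℕ) (b : Space n) :
    ContDiff ℝ ∞ (bandTaylor V q b) := by
  obtain ⟨P, -, hP⟩ := exists_polyFun_eq_bandTaylor hV (Nat.le_succ q) b
  rw [← hP]
  exact contDiff_polyFun P

lemma partialDeriv_bandTaylor {R : ℝ} {V : Space n → ℂ} (hV : IsBand R V) (q : ℕ) (b : Space n)
    (i : Fin n) :
    partialDeriv i (bandTaylor V q b)
      = bandTaylor (fun ξ => (2 * π * I * ξ i) * V ξ) (q - 1) b := by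
  ext x
  set e : Space n := EuclideanSpace.single i 1 with he
  have hd : DifferentiableAt ℝ (bandTaylor V q b) x :=
    (contDiff_bandTaylor hV q b).differentiable (by simp) x
  have h1 : HasDerivAt (fun s : ℝ => bandTaylor V q b (x + s • e))
      (partialDeriv i (bandTaylor V q b) x) 0 := hd.hasFDerivAt.hasLineDerivAt e
  refine h1.unique ?_
  have hphase : ∀ (s : ℝ) ξ, phase (x + s • e - b) ξ = phase (x - b) ξ + s * phase e ξ := by
    intro s ξ
    rw [add_sub_right_comm, phase_add, phase_smul]
  obtain ⟨C, hC⟩ := ((isCompact_Icc (a := (-1 : ℝ)) (b := 1)).prod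
    (isCompact_closedBall (0 : Space n) R)).exists_bound_of_continuousOn
    (f := fun z : ℝ × Space n =>
      expSum (q - 1) (phase (x + z.1 • e - b) z.2) * phase e z.2)
    (Continuous.continuousOn (((continuous_expSum _).comp (continuous_phase.comp (by fun_prop :
      Continuous fun z : ℝ × Space n => (x + z.1 • e - b, z.2)))).mul
      ((continuous_phase_right e).comp continuous_snd)))
  have key := hasDerivAt_integral_of_dominated_loc_of_deriv_le (𝕜 := ℝ)
    (μ := (volume : Measure (Space n))) (x₀ := 0) (s := Set.Icc (-1) 1)
    (F := fun s ξ => wave b ξ * expSum q (phase (x + s • e - b) ξ) * V ξ)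
    (F' := fun s ξ =>
      wave b ξ * (expSum (q - 1) (phase (x + s • e - b) ξ) * phase e ξ) * V ξ)
    (bound := fun ξ => C * ‖V ξ‖) (Icc_mem_nhds (by norm_num) (by norm_num)) ?_ ?_ ?_ ?_ ?_ ?_
  · refine key.2.congr_deriv ?_
    rw [bandTaylor]
    congr 1
    ext ξ
    rw [zero_smul, add_zero, ← phase_single]
    ring
  · refine .of_forall fun s => ?_
    exact ((hV.mul ((continuous_wave_right b).mul
      ((continuous_expSum q).comp (continuous_phase_right _)))).stronglyMeasurable
      ).aestronglyMeasurable
  · exact (hV.mul ((continuous_wave_right b).mul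
      ((continuous_expSum q).comp (continuous_phase_right _)))).integrable
  · exact ((hV.mul ((continuous_wave_right b).mul (((continuous_expSum _).comp
      (continuous_phase_right _)).mul (continuous_phase_right e)))).stronglyMeasurable
      ).aestronglyMeasurable
  · refine .of_forall fun ξ s hs => ?_
    rw [norm_mul, norm_mul, norm_wave, one_mul]
    by_cases hξ : R < ‖ξ‖
    · simp [hV.eq_zero ξ hξ]
    · gcongr
      exact hC (s, ξ) ⟨hs, by simpa using hξ⟩
  · exact hV.integrable.norm.const_mul C
  · refine .of_forall fun ξ s _ => ?_
    simp only [hphase]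
    have h2 : HasDerivAt (fun s : ℝ => phase (x - b) ξ + s * phase e ξ) (phase e ξ) s := by
      simpa using ((hasDerivAt_id s).ofReal_comp.mul_const (phase e ξ)).const_add
        (phase (x - b) ξ)
    exact (((hasDerivAt_expSum q _).comp s h2).const_mul _).mul_const _

lemma partialDeriv_iterate_bandTaylor {R : ℝ} {V : Space n → ℂ} (hV : IsBand R V) (q : ℕ)
    (b : Space n) (i : Fin n) (k : ℕ) :
    (partialDeriv i)^[k] (bandTaylor V q b)
      = bandTaylor (fun ξ => (2 * π * I * ξ i) ^ k * V ξ) (q - k) b := by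
  induction k with
  | zero => simp
  | succ k ih =>
    rw [Function.iterate_succ_apply', ih, partialDeriv_bandTaylor (hV.mul (by fun_prop)),
      Nat.sub_sub]
    congr 1
    ext ξ
    ring

lemma foldl_bandTaylor {R : ℝ} {V : Space n → ℂ} (hV : IsBand R V) (q : ℕ)
    (b : Space n) (α : Fin n → ℕ) (l : List (Fin n)) :
    l.foldl (fun ψ i => (partialDeriv i)^[α i] ψ) (bandTaylor V q b)
      = bandTaylor (fun ξ => (l.map fun i => (2 * π * I * ξ i) ^ α i).prod * V ξ)
          (q - (l.map α).sum) b := by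
  induction l generalizing V q with
  | nil => simp
  | cons i l ih =>
    rw [List.foldl_cons, partialDeriv_iterate_bandTaylor hV, ih (hV.mul (by fun_prop)),
      List.map_cons, List.sum_cons, Nat.sub_sub]
    congr 1
    ext ξ
    rw [List.map_cons, List.prod_cons]
    ring

lemma hasWeakDeriv_bandTaylor {R : ℝ} {V : Space n → ℂ} (hV : IsBand R V) (q : ℕ)
    (b : Space n) (α : Fin n → ℕ) (G : Set (Space n)) :
    HasWeakDeriv G α (bandTaylor V q b)
      (bandTaylor (fun ξ => symbol α ξ * V ξ) (q - ∑ i, α i) b) := by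
  have h := hasWeakDeriv_of_contDiff (contDiff_bandTaylor hV q b) α G
  rw [revMultiDeriv, foldl_bandTaylor hV, ← Fin.sum_univ_def] at h
  simp_rw [← Fin.prod_univ_def] at h
  exact h

/-- Plancherel's identity in the centre `b` of the Taylor polynomial, for a fixed offset `y`. -/
lemma eLpNorm_sub_bandTaylor {R : ℝ} {V W g : Space n → ℂ} (hV : IsBand R V)
    (hg : IsSpectrum W g) (q : ℕ) (y : Space n) :
    eLpNorm (fun b => g (b + y) - bandTaylor V q b (b + y)) 2 volume
      = eLpNorm (fun ξ => wave y ξ * W ξ - expSum q (phase y ξ) * V ξ) 2 volume := by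
  have hV' := hV.mul ((continuous_expSum q).comp (continuous_phase_right y))
  have h := (hg.translate y).sub (isSpectrum_integral_wave hV'.integrable hV'.memLp)
  refine IsSpectrum.eLpNorm_eq (h.congr .rfl (.of_forall fun b => ?_))
  simp only [Pi.sub_apply, bandTaylor, add_sub_cancel_left, Function.comp, mul_assoc]

end BandTaylor

/-! ### The Fourier multiplier of the approximation error -/

section Multiplier

open Complex
open scoped Real

variable {n : ℕ}

lemma norm_exp_sub_expSum_le (q : ℕ) (z : ℂ) :
    ‖cexp z - expSum q z‖ ≤ ‖z‖ ^ q / q.factorial * Real.exp ‖z‖ := by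
  refine (Complex.norm_exp_sub_sum_le_exp_norm_sub_sum z q).trans ?_
  set r := ‖z‖ with hr
  have hr0 : 0 ≤ r := norm_nonneg z
  have h1 : HasSum (fun k : ℕ => r ^ k / k.factorial) (Real.exp r) := by
    have := NormedSpace.expSeries_div_hasSum_exp r
    rwa [← Real.exp_eq_exp_ℝ] at this
  have h2 := (hasSum_nat_add_iff' q).2 h1
  refine hasSum_le (fun k => ?_) h2 (h1.mul_left (r ^ q / q.factorial))
  rw [pow_add, div_mul_div_comm, mul_comm (r ^ k)]
  gcongr
  have := Nat.factorial_mul_factorial_dvd_factorial_add q k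
  rw [add_comm k q]
  exact_mod_cast Nat.le_of_dvd (Nat.factorial_pos _) this

/-- The error multiplier at low frequencies: the factor `4^{-N}` gained from `|z| ≤ N / 4` beats
the factor `e^{5N/4}` coming from the bound `N^k / k! ≤ e^N` and from `e^{|z|}`. -/
lemma norm_exp_sub_expSum_le_of_le {N i t : ℕ} (hit : i ≤ t) (htN : t ≤ N) (hN : 0 < N) {z : ℂ}
    (hz : ‖z‖ ≤ N / 4) :
    ‖cexp z - expSum (N - i) z‖ ≤ 4 ^ t * (‖z‖ ^ (t - i)) / (N : ℝ) ^ (t - i) := by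
  have hN' : (0 : ℝ) < N := by exact_mod_cast hN
  refine (norm_exp_sub_expSum_le _ z).trans ?_
  have e1 : N - i = (t - i) + (N - t) := by omega
  have h1 : ‖z‖ ^ (N - i) ≤ ‖z‖ ^ (t - i) * (N / 4 : ℝ) ^ (N - t) := by
    rw [e1, pow_add]
    gcongr
  have h2 : (N : ℝ) ^ (N - i) / (N - i).factorial ≤ Real.exp N :=
    Real.pow_div_factorial_le_exp _ hN'.le _
  have h3 : Real.exp ‖z‖ ≤ Real.exp (N / 4) := Real.exp_le_exp.2 hz
  have h4 : Real.exp N * Real.exp (N / 4) ≤ 4 ^ N := by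
    have : Real.exp N * Real.exp (N / 4) = (Real.exp (5 / 4)) ^ N := by
      rw [← Real.exp_add, ← Real.exp_nat_mul]
      ring_nf
    rw [this]
    gcongr
    have h5 : Real.exp (5 / 4) ^ 4 ≤ 4 ^ 4 := by
      have : Real.exp (5 / 4) ^ 4 = Real.exp 1 ^ 5 := by
        rw [← Real.exp_nat_mul, ← Real.exp_nat_mul]; norm_num
      rw [this]
      calc Real.exp 1 ^ 5 ≤ 2.7182818286 ^ 5 := by
            gcongr; exact Real.exp_one_lt_d9.le
        _ ≤ 4 ^ 4 := by norm_num
    exact le_of_pow_le_pow_left₀ (by norm_num) (by norm_num) h5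
  have e2 : (4 : ℝ) ^ N = 4 ^ t * 4 ^ (N - t) := by rw [← pow_add]; congr 1; omega
  have e3 : (N : ℝ) ^ (N - i) = N ^ (t - i) * N ^ (N - t) := by rw [← pow_add, e1]
  rw [le_div_iff₀ (by positivity)]
  calc ‖z‖ ^ (N - i) / (N - i).factorial * Real.exp ‖z‖ * N ^ (t - i)
      ≤ ‖z‖ ^ (t - i) * (N / 4 : ℝ) ^ (N - t) / (N - i).factorial * Real.exp (N / 4)
          * N ^ (t - i) := by gcongr
    _ = ‖z‖ ^ (t - i) / 4 ^ (N - t) * ((N : ℝ) ^ (N - i) / (N - i).factorial)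
          * Real.exp (N / 4) := by
        rw [e3, div_pow]; ring
    _ ≤ ‖z‖ ^ (t - i) / 4 ^ (N - t) * Real.exp N * Real.exp (N / 4) := by gcongr
    _ = ‖z‖ ^ (t - i) / 4 ^ (N - t) * (Real.exp N * Real.exp (N / 4)) := by ring
    _ ≤ ‖z‖ ^ (t - i) / 4 ^ (N - t) * 4 ^ N := by gcongr
    _ = 4 ^ t * ‖z‖ ^ (t - i) := by
        rw [e2]; field_simp

/-- The multiplier of the error between a function and the local Taylor polynomials, with offset
`y`, of its low-frequency part: `e^{2πi⟨y, ξ⟩}`, minus `q` terms of its exponential series if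
`|ξ| ≤ R`. -/
noncomputable def errorMultiplier (R : ℝ) (q : ℕ) (y ξ : Space n) : ℂ :=
  wave y ξ - if ‖ξ‖ ≤ R then expSum q (phase y ξ) else 0

lemma norm_errorMultiplier_zero (R : ℝ) (y ξ : Space n) : ‖errorMultiplier R 0 y ξ‖ = 1 := by
  simp [errorMultiplier, expSum_zero, norm_wave]

/-- The choice `R = N / (8πDh)` makes the phase at most `N / 4` at frequencies below `R`. -/
lemma norm_errorMultiplier_le {D h : ℝ} (hD : 1 ≤ D) (hh : 0 < h) {N i t m : ℕ} (hit : i ≤ t)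
    (htN : t ≤ N) (htm : t ≤ m) (hN : 0 < N) {y : Space n} (hy : ‖y‖ ≤ D * h) (ξ : Space n) :
    ‖errorMultiplier (N / (8 * π * D * h)) (N - i) y ξ‖
      ≤ (8 * π * D) ^ m * (h * ‖ξ‖ / N) ^ (t - i) := by
  have hN' : (0 : ℝ) < N := by exact_mod_cast hN
  have hπ : 1 ≤ 2 * π := by linarith [Real.pi_gt_three]
  have hD0 : 0 < D := by linarith
  have h2D : 1 ≤ 2 * π * D := by nlinarith
  have h8D : 1 ≤ 8 * π * D := by nlinarith
  rw [errorMultiplier]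
  split_ifs with hξ
  · have hz : ‖phase y ξ‖ ≤ 2 * π * D * h * ‖ξ‖ := by
      refine (norm_phase_le y ξ).trans ?_
      calc 2 * π * (‖y‖ * ‖ξ‖) ≤ 2 * π * (D * h * ‖ξ‖) := by gcongr
        _ = _ := by ring
    have hz4 : ‖phase y ξ‖ ≤ N / 4 := by
      refine hz.trans ?_
      rw [le_div_iff₀ (by positivity)] at hξ
      linarith
    refine (norm_exp_sub_expSum_le_of_le hit htN hN hz4).trans ?_
    calc 4 ^ t * ‖phase y ξ‖ ^ (t - i) / (N : ℝ) ^ (t - i)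
        ≤ 4 ^ t * (2 * π * D * h * ‖ξ‖) ^ (t - i) / (N : ℝ) ^ (t - i) := by gcongr
      _ = 4 ^ t * (2 * π * D) ^ (t - i) * (h * ‖ξ‖ / N) ^ (t - i) := by
          rw [div_pow, mul_assoc (2 * π * D), mul_pow (2 * π * D)]; ring
      _ ≤ 4 ^ m * (2 * π * D) ^ m * (h * ‖ξ‖ / N) ^ (t - i) := by
          gcongr
          · norm_num
          · omega
      _ = _ := by rw [← mul_pow]; ring_nf
  · rw [sub_zero, norm_wave]
    rw [not_le, div_lt_iff₀ (by positivity)] at hξ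
    have h1 : 1 ≤ 8 * π * D * (h * ‖ξ‖ / N) := by
      rw [← mul_div_assoc, le_div_iff₀ hN']
      linarith
    calc (1 : ℝ) ≤ (8 * π * D * (h * ‖ξ‖ / N)) ^ (t - i) := one_le_pow₀ h1
      _ = (8 * π * D) ^ (t - i) * (h * ‖ξ‖ / N) ^ (t - i) := mul_pow _ _ _
      _ ≤ _ := by
        gcongr
        omega

end Multiplier

/-! ### Grid cells and averaging over the centres -/

section Cells

variable {n : ℕ}

/-- The index of the cell of the cubic grid of width `h` that contains `x`. -/
noncomputable def gridIndex (h : ℝ) (x : Space n) : Fin n → ℤ := fun i => ⌊x i / h⌋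

lemma measurable_gridIndex (h : ℝ) : Measurable (gridIndex h : Space n → Fin n → ℤ) := by
  refine measurable_pi_lambda _ fun i => Int.measurable_floor.comp ?_
  exact (by fun_prop : Continuous fun x : Space n => x i / h).measurable

lemma measurableSet_cell (h : ℝ) (c : Fin n → ℤ) :
    MeasurableSet {x : Space n | gridIndex h x = c} :=
  measurable_gridIndex h (MeasurableSet.singleton c)

lemma volume_cell {h : ℝ} (hh : 0 < h) (c : Fin n → ℤ) :
    volume {x : Space n | gridIndex h x = c} = ENNReal.ofReal h ^ n := by
  have hset : {x : Space n | gridIndex h x = c}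
      = (MeasurableEquiv.toLp 2 (Fin n → ℝ)).symm ⁻¹'
        Set.pi Set.univ (fun i => Set.Ico (c i * h) ((c i + 1) * h)) := by
    ext x
    simp only [Set.mem_ofPred_eq, Set.mem_preimage, Set.mem_pi, Set.mem_univ, true_imp_iff,
      Set.mem_Ico, gridIndex, funext_iff, Int.floor_eq_iff, le_div_iff₀ hh, div_lt_iff₀ hh]
    rfl
  rw [hset, (EuclideanSpace.volume_preserving_symm_measurableEquiv_toLp (Fin n)
    ).measure_preimage_equiv, Real.volume_pi_Ico]
  simp [add_mul]

lemma dist_le_of_gridIndex_eq {h : ℝ} (hh : 0 < h) {x y : Space n}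
    (hxy : gridIndex h x = gridIndex h y) : dist x y ≤ n * h := by
  rw [EuclideanSpace.dist_eq]
  have h1 : ∀ i, dist (x i) (y i) ≤ h := by
    intro i
    have h2 := Int.abs_sub_lt_one_of_floor_eq_floor (congrFun hxy i)
    rw [← sub_div, abs_div, abs_of_pos hh, div_lt_one hh] at h2
    exact h2.le
  refine Real.sqrt_le_iff.2 ⟨by positivity, ?_⟩
  calc ∑ i, dist (x i) (y i) ^ 2 ≤ ∑ _i : Fin n, h ^ 2 := by
        gcongr with i
        exact h1 i
    _ = n * h ^ 2 := by simp
    _ ≤ (n * h) ^ 2 := by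
        rw [mul_pow]
        gcongr
        exact_mod_cast Nat.le_self_pow two_ne_zero n

lemma exists_mem_mul_measure_le {X : Type*} [MeasurableSpace X] {μ : Measure X} {s : Set X}
    (h0 : μ s ≠ 0) (htop : μ s ≠ ⊤) {f : X → ℝ≥0∞} (hf : Measurable f) :
    ∃ x ∈ s, μ s * f x ≤ ∫⁻ a in s, f a ∂μ := by
  obtain ⟨x, hx, hle⟩ := exists_le_setLAverage h0 htop hf.aemeasurable
  refine ⟨x, hx, ?_⟩
  rw [setLAverage_eq] at hle
  rwa [mul_comm, ← ENNReal.le_div_iff_mul_le (.inl h0) (.inl htop)]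

/-- Each element of the mesh gets a centre, the same for all elements assigned to the same grid
cell, so that the errors relative to these centres add up to at most an average over all centres.
Elements assigned to one cell are pairwise disjoint, so their number does not matter. -/
lemma exists_centers {h : ℝ} (hh : 0 < h) {T : Set (Set (Space n))} (hc : T.Countable)
    (hne : ∀ K ∈ T, K.Nonempty) (ho : ∀ K ∈ T, IsOpen K)
    (hd : ∀ K ∈ T, ∀ K' ∈ T, K ≠ K' → K ∩ K' = ∅)
    (hdiam : ∀ K ∈ T, ∀ x ∈ K, ∀ y ∈ K, dist x y ≤ h)
    {E : Space n × Space n → ℝ≥0∞} (hE : Measurable E) :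
    ∃ β : Set (Space n) → Space n,
      ∑' K : T, ∫⁻ x in (K : Set (Space n)), E (β K, x)
        ≤ (ENNReal.ofReal h ^ n)⁻¹ *
          ∫⁻ y in Metric.ball (0 : Space n) ((n + 2) * h), ∫⁻ b, E (b, b + y) := by
  classical
  have hcT : Countable T := hc.to_subtype
  -- the cell of an element is that of one of its points
  choose pt hpt using fun K : T => hne K K.2
  set κ : T → (Fin n → ℤ) := fun K => gridIndex h (pt K) with hκ
  set cell : (Fin n → ℤ) → Set (Space n) := fun c => {x | gridIndex h x = c} with hcell
  set Ωc : (Fin n → ℤ) → Set (Space n) := fun c => ⋃ K : {K : T // κ K = c}, (K.1 : Set _)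
    with hΩc
  have hmeas : ∀ b, Measurable fun x => E (b, x) := fun b => hE.comp measurable_prodMk_left
  have hvol : ∀ c, volume (cell c) = ENNReal.ofReal h ^ n := volume_cell hh
  have hv0 : ENNReal.ofReal h ^ n ≠ 0 := pow_ne_zero _ (by simpa using hh)
  have hvt : ENNReal.ofReal h ^ n ≠ ⊤ := ENNReal.pow_ne_top ENNReal.ofReal_ne_top
  have hΦ : ∀ c, Measurable fun b => ∫⁻ x in Ωc c, E (b, x) := fun c => hE.lintegral_prod_right'
  choose ctr hctr hle using fun c =>
    exists_mem_mul_measure_le (μ := volume) (s := cell c) (by rw [hvol]; exact hv0)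
      (by rw [hvol]; exact hvt) (hΦ c)
  have hsub : ∀ c, ∀ b ∈ cell c, Ωc c ⊆ Metric.ball b ((n + 2) * h) := by
    intro c b hb x hx
    obtain ⟨⟨K, hK⟩, hxK⟩ := Set.mem_iUnion.1 hx
    have h1 := hdiam K K.2 x hxK (pt K) (hpt K)
    have h2 : dist (pt K) b ≤ n * h := dist_le_of_gridIndex_eq hh (hK.trans hb.symm)
    rw [Metric.mem_ball]
    calc dist x b ≤ dist x (pt K) + dist (pt K) b := dist_triangle _ _ _
      _ < (n + 2) * h := by linarith
  -- shifting the variable `x = b + y`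
  have hshift : ∀ b, ∫⁻ x in Metric.ball b ((n + 2) * h), E (b, x)
      = ∫⁻ y in Metric.ball (0 : Space n) ((n + 2) * h), E (b, b + y) := by
    intro b
    rw [← lintegral_indicator Metric.isOpen_ball.measurableSet,
      ← lintegral_indicator Metric.isOpen_ball.measurableSet,
      ← lintegral_add_left_eq_self _ b]
    congr 1
    ext y
    simp [Set.indicator]
  have hE2 : Measurable fun z : Space n × Space n => E (z.1, z.1 + z.2) :=
    hE.comp (by fun_prop)
  have hcells : ⋃ c, cell c = Set.univ := Set.eq_univ_of_forall fun x => Set.mem_iUnion.2 ⟨_, rfl⟩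
  have hcelld : Pairwise (Function.onFun Disjoint cell) := by
    intro c c' hcc
    exact Set.disjoint_left.2 fun x hx hx' => hcc (hx.symm.trans hx')
  set β : Set (Space n) → Space n := fun K => if hK : K ∈ T then ctr (κ ⟨K, hK⟩) else 0 with hβ
  have hβT : ∀ K : T, β K = ctr (κ K) := fun K => dif_pos K.2
  refine ⟨β, ?_⟩
  have hsum : ∑' K : T, ∫⁻ x in (K : Set (Space n)), E (β K, x)
      = ∑' c, ∫⁻ x in Ωc c, E (ctr c, x) := by
    rw [← (Equiv.sigmaFiberEquiv κ).tsum_eq, ENNReal.tsum_sigma']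
    congr 1
    ext c
    have hct : Countable {K : T // κ K = c} := inferInstance
    rw [hΩc, lintegral_iUnion (fun K => (ho _ K.1.2).measurableSet)]
    · congr 1
      ext K
      simp only [Equiv.sigmaFiberEquiv, Equiv.coe_fn_mk, hβT, K.2]
    · intro K K' hKK
      refine Set.disjoint_iff_inter_eq_empty.2 (hd _ K.1.2 _ K'.1.2 fun h' => hKK ?_)
      exact Subtype.ext (Subtype.ext h')
  rw [hsum, mul_comm, ← div_eq_mul_inv, ENNReal.le_div_iff_mul_le (.inl hv0) (.inl hvt),
    mul_comm, ← ENNReal.tsum_mul_left]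
  calc ∑' c, ENNReal.ofReal h ^ n * ∫⁻ x in Ωc c, E (ctr c, x)
      ≤ ∑' c, ∫⁻ b in cell c, ∫⁻ x in Ωc c, E (b, x) := by
        refine ENNReal.tsum_le_tsum fun c => ?_
        have := hle c
        rwa [hvol] at this
    _ ≤ ∑' c, ∫⁻ b in cell c,
          ∫⁻ y in Metric.ball (0 : Space n) ((n + 2) * h), E (b, b + y) := by
        refine ENNReal.tsum_le_tsum fun c => ?_
        refine setLIntegral_mono' (measurableSet_cell h c) fun b hb => ?_
        rw [← hshift]
        exact lintegral_mono_set (hsub c b hb)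
    _ = ∫⁻ b, ∫⁻ y in Metric.ball (0 : Space n) ((n + 2) * h), E (b, b + y) := by
        rw [← lintegral_iUnion (measurableSet_cell h) hcelld, hcells, Measure.restrict_univ]
    _ = _ := lintegral_lintegral_swap hE2.aemeasurable

end Cells

/-! ### Best approximation by polynomials on one element -/

section BestApproximation

variable {n : ℕ} {K : Set (Space n)}

lemma memLp_restrict_of_continuous (hK : Bornology.IsBounded K) {f : Space n → ℂ}
    (hf : Continuous f) : MemLp f 2 (volume.restrict K) := by
  have hc : IsCompact (closure K) := hK.isCompact_closure
  have : IsFiniteMeasure (volume.restrict (closure K)) := ⟨by simpa using hc.measure_lt_top⟩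
  obtain ⟨C, hC⟩ := hc.exists_bound_of_continuousOn hf.continuousOn
  have h : MemLp f 2 (volume.restrict (closure K)) :=
    MemLp.of_bound hf.aestronglyMeasurable C
      ((ae_restrict_iff' isClosed_closure.measurableSet).2 (.of_forall hC))
  exact h.mono_measure (Measure.restrict_mono subset_closure le_rfl)

lemma sum_enorm_sq_eq {ι : Type*} [Fintype ι] {β : ι → Type*} [∀ i, NormedAddCommGroup (β i)]
    (x : PiLp 2 β) : ∑ i, ‖x i‖ₑ ^ 2 = ‖x‖ₑ ^ 2 := by
  simp_rw [← ofReal_norm, ← ENNReal.ofReal_pow (norm_nonneg _)]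
  rw [← ENNReal.ofReal_sum_of_nonneg fun i _ => by positivity, PiLp.norm_sq_eq_of_L2]

/-- The weak derivatives up to order `j` of a polynomial, as a tuple in `L²(K)`. The map is
linear because weak derivatives are unique. -/
noncomputable def polyDerivs (hK : Bornology.IsBounded K) (ho : IsOpen K) (j p : ℕ) :
    MvPolynomial.restrictTotalDegree (Fin n) ℂ p →ₗ[ℂ]
      PiLp 2 (fun _ : multiIndices n j => Lp ℂ 2 (volume.restrict K)) where
  toFun P := WithLp.toLp 2 fun α =>
    (memLp_restrict_of_continuous hK (contDiff_revMultiDeriv (contDiff_polyFun P.1) α).continuous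
      ).toLp (revMultiDeriv α (polyFun P.1))
  map_add' P Q := by
    ext1 α
    simp only [PiLp.add_apply]
    rw [← MemLp.toLp_add, MemLp.toLp_eq_toLp_iff]
    refine HasWeakDeriv.unique ho (α := α) (w := polyFun (P + Q : MvPolynomial (Fin n) ℂ))
      (hasWeakDeriv_of_contDiff (contDiff_polyFun _) α K) ?_
    have h := (hasWeakDeriv_of_contDiff (contDiff_polyFun P.1) α K).add
      (hasWeakDeriv_of_contDiff (contDiff_polyFun Q.1) α K)
    refine h.congr (.of_forall fun x => ?_) .rfl
    simp [polyFun]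
  map_smul' c P := by
    ext1 α
    simp only [PiLp.smul_apply, RingHom.id_apply]
    rw [← MemLp.toLp_const_smul, MemLp.toLp_eq_toLp_iff]
    refine HasWeakDeriv.unique ho (α := α) (w := polyFun (c • P : MvPolynomial (Fin n) ℂ))
      (hasWeakDeriv_of_contDiff (contDiff_polyFun _) α K) ?_
    have h := (hasWeakDeriv_of_contDiff (contDiff_polyFun P.1) α K).const_smul c
    refine h.congr (.of_forall fun x => ?_) .rfl
    simp [polyFun]

lemma exists_best_approximation (hK : Bornology.IsBounded K) (ho : IsOpen K) {j : ℕ} (p : ℕ)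
    {u : Space n → ℂ} (hu : ∀ α ∈ multiIndices n j, ∃ g, HasWeakDeriv K α u g ∧
      MemLp g 2 (volume.restrict K)) :
    ∃ P : MvPolynomial (Fin n) ℂ, P.totalDegree ≤ p ∧
      ∀ Q : MvPolynomial (Fin n) ℂ, Q.totalDegree ≤ p →
        sobolevNorm K j (u - polyFun P) ≤ sobolevNorm K j (u - polyFun Q) := by
  choose g hg hgm using fun α : multiIndices n j => hu α α.2
  set L := polyDerivs hK ho j p with hL
  set a : PiLp 2 (fun _ : multiIndices n j => Lp ℂ 2 (volume.restrict K)) :=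
    WithLp.toLp 2 fun α => (hgm α).toLp (g α) with ha
  have key : ∀ Q : MvPolynomial.restrictTotalDegree (Fin n) ℂ p,
      sobolevNorm K j (u - polyFun Q.1) ^ 2 = ‖a - L Q‖ₑ ^ 2 := by
    intro Q
    rw [sobolevNorm_sq, ← sum_enorm_sq_eq, ← Finset.sum_coe_sort]
    refine Finset.sum_congr rfl fun α _ => ?_
    rw [weakDerivNorm_eq ho ((hg α).sub (hasWeakDeriv_of_contDiff (contDiff_polyFun Q.1) α K))]
    congr 1
    rw [PiLp.sub_apply, ha, hL, polyDerivs]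
    simp only [LinearMap.coe_mk, AddHom.coe_mk]
    rw [← MemLp.toLp_sub, Lp.enorm_def]
    exact (eLpNorm_congr_ae (MemLp.coeFn_toLp _)).symm
  have : FiniteDimensional ℂ (LinearMap.range L) := inferInstance
  obtain ⟨v, ⟨P, rfl⟩, hmin⟩ := Submodule.exists_norm_eq_iInf_of_complete_subspace
    (LinearMap.range L) (Submodule.complete_of_finiteDimensional _) a
  refine ⟨P.1, (MvPolynomial.mem_restrictTotalDegree _ _ _).1 P.2, fun Q hQ => ?_⟩
  have hQ' := (MvPolynomial.mem_restrictTotalDegree _ _ _).2 hQ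
  have hle : ‖a - L P‖ ≤ ‖a - L ⟨Q, hQ'⟩‖ := by
    rw [hmin]
    refine ciInf_le ⟨0, ?_⟩ (⟨L ⟨Q, hQ'⟩, LinearMap.mem_range_self _ _⟩ : LinearMap.range L)
    rintro _ ⟨w, rfl⟩
    exact norm_nonneg _
  have hle' : ‖a - L P‖ₑ ^ 2 ≤ ‖a - L ⟨Q, hQ'⟩‖ₑ ^ 2 := by
    gcongr
    rwa [enorm_le_iff_norm_le]
  rw [← key, ← key] at hle'
  exact (ENNReal.pow_le_pow_left_iff two_ne_zero).1 hle'

end BestApproximation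

/-! ### Error estimates -/

section ErrorEstimate

open Complex
open scoped Real Nat

variable {n : ℕ}

lemma eLpNorm_two_sq {X : Type*} [MeasurableSpace X] (μ : Measure X) (f : X → ℂ) :
    eLpNorm f 2 μ ^ 2 = ∫⁻ x, ‖f x‖ₑ ^ 2 ∂μ := by
  have h := eLpNorm_nnreal_pow_eq_lintegral (μ := μ) (f := f) (p := 2) two_ne_zero
  simpa using h

lemma norm_symbol_sq (γ : Fin n → ℕ) (ξ : Space n) :
    ‖symbol γ ξ‖ ^ 2 = ∏ i, ((2 * π * ξ i) ^ 2) ^ γ i := by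
  rw [symbol, norm_prod, ← Finset.prod_pow]
  refine Finset.prod_congr rfl fun i _ => ?_
  rw [norm_pow, pow_right_comm]
  congr 1
  simp only [norm_mul, Complex.norm_ofNat, norm_real, norm_I, mul_one, Real.norm_eq_abs, mul_pow,
    sq_abs]

lemma pow_norm_sq_le_sum_symbol (r : ℕ) (ξ : Space n) :
    ((2 * π * ‖ξ‖) ^ r) ^ 2
      ≤ r ! * ∑ γ ∈ Finset.piAntidiag (Finset.univ : Finset (Fin n)) r, ‖symbol γ ξ‖ ^ 2 := by
  have h1 : (2 * π * ‖ξ‖) ^ 2 = ∑ i, (2 * π * ξ i) ^ 2 := by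
    rw [mul_pow, EuclideanSpace.norm_sq_eq, Finset.mul_sum]
    refine Finset.sum_congr rfl fun i _ => ?_
    rw [Real.norm_eq_abs, sq_abs, mul_pow _ (ξ i)]
  rw [← pow_mul, mul_comm r 2, pow_mul, h1, Finset.sum_pow_eq_sum_piAntidiag, Finset.mul_sum]
  refine Finset.sum_le_sum fun γ hγ => ?_
  rw [norm_symbol_sq]
  gcongr
  rw [Nat.multinomial, (Finset.mem_piAntidiag.1 hγ).1]
  exact Nat.div_le_self _ _

lemma IsSpectrum.weakDerivNorm_eq {W U : Space n → ℂ} (h : IsSpectrum W U) {α : Fin n → ℕ}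
    (hα : MemLp (fun ξ => symbol α ξ * W ξ) 2 volume) :
    weakDerivNorm Set.univ α U = eLpNorm (fun ξ => symbol α ξ * W ξ) 2 volume := by
  obtain ⟨g, -, hg⟩ := exists_isSpectrum hα
  rw [PiecewisePoly.weakDerivNorm_eq isOpen_univ (h.hasWeakDeriv hg), Measure.restrict_univ,
    hg.eLpNorm_eq]

lemma IsSpectrum.eLpNorm_pow_le {W U : Space n → ℂ} (h : IsSpectrum W U) {m r : ℕ}
    (hr : r ≤ m) (hW : StronglyMeasurable W)
    (hm : ∀ k ≤ m, MemLp (fun ξ => (‖ξ‖ ^ k : ℝ) * W ξ) 2 volume) :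
    eLpNorm (fun ξ => ((2 * π * ‖ξ‖) ^ r : ℝ) * W ξ) 2 volume
      ≤ (m ! : ℝ≥0∞) * sobolevSeminorm Set.univ r U := by
  rw [← ENNReal.pow_le_pow_left_iff two_ne_zero]
  have h1 : ∀ γ ∈ Finset.piAntidiag (Finset.univ : Finset (Fin n)) r,
      weakDerivNorm Set.univ γ U ^ 2 = ∫⁻ ξ, ‖symbol γ ξ * W ξ‖ₑ ^ 2 := by
    intro γ hγ
    rw [h.weakDerivNorm_eq (memLp_symbol_mul hW hm ((Finset.mem_piAntidiag.1 hγ).1.trans_le hr)),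
      eLpNorm_two_sq]
  have hmeas : ∀ γ : Fin n → ℕ, Measurable fun ξ => ‖symbol γ ξ * W ξ‖ₑ ^ 2 := fun γ =>
    (((continuous_symbol γ).measurable.mul hW.measurable).enorm).pow_const 2
  rw [mul_pow, sobolevSeminorm_sq, Finset.sum_congr rfl h1, eLpNorm_two_sq,
    ← lintegral_finsetSum _ fun γ _ => hmeas γ,
    ← lintegral_const_mul _ (Finset.measurable_sum _ fun γ _ => hmeas γ)]
  refine lintegral_mono fun ξ => ?_
  have h2 : (r ! : ℝ) ≤ (m ! : ℝ) ^ 2 := by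
    have h3 : (r ! : ℝ) ≤ m ! := by exact_mod_cast Nat.factorial_le hr
    have h4 : (1 : ℝ) ≤ m ! := by exact_mod_cast Nat.factorial_pos m
    nlinarith
  have h5 : ‖((2 * π * ‖ξ‖) ^ r : ℝ) * W ξ‖ ^ 2
      ≤ (m ! : ℝ) ^ 2 * ∑ γ ∈ Finset.piAntidiag (Finset.univ : Finset (Fin n)) r,
        ‖symbol γ ξ * W ξ‖ ^ 2 := by
    simp_rw [norm_mul, mul_pow _ ‖W ξ‖]
    rw [← Finset.sum_mul, ← mul_assoc, norm_real, Real.norm_of_nonneg (by positivity)]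
    gcongr
    refine (pow_norm_sq_le_sum_symbol r ξ).trans ?_
    gcongr
  have h6 := ENNReal.ofReal_le_ofReal h5
  rw [ENNReal.ofReal_mul (by positivity), ENNReal.ofReal_sum_of_nonneg fun _ _ => by positivity,
    ENNReal.ofReal_pow (by positivity), ENNReal.ofReal_pow (by positivity), ofReal_norm,
    ENNReal.ofReal_natCast] at h6
  simp_rw [ENNReal.ofReal_pow (norm_nonneg _), ofReal_norm] at h6
  exact h6

lemma IsSpectrum.sobolevSeminorm_lt_top {W U : Space n → ℂ} (h : IsSpectrum W U) {m r : ℕ}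
    (hr : r ≤ m) (hW : StronglyMeasurable W)
    (hm : ∀ k ≤ m, MemLp (fun ξ => (‖ξ‖ ^ k : ℝ) * W ξ) 2 volume) :
    sobolevSeminorm Set.univ r U < ⊤ := by
  refine ENNReal.rpow_lt_top_of_nonneg (by norm_num) (ENNReal.sum_lt_top.2 fun α hα => ?_).ne
  have hα' := memLp_symbol_mul hW hm ((Finset.mem_piAntidiag.1 hα).1.trans_le hr)
  rw [h.weakDerivNorm_eq hα']
  exact ENNReal.pow_lt_top hα'.2

/-- The factor `(h / N)^{t - i}` gained on derivatives of order `i ≤ t`, compared with the claimed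
rate. If `N < m` then the powers of `N` are bounded by powers of `m`. -/
lemma rate_le_of_le {h H : ℝ} (hh : 0 < h) (hH : 1 ≤ H) (hhH : h ≤ H) {N m i j : ℕ} (hN : 0 < N)
    (hm : 1 ≤ m) (hij : i ≤ j) (hjm : j ≤ m) (hit : i ≤ min m N) :
    (h / N) ^ (min m N - i)
      ≤ H ^ m * m ^ m * (h ^ (((min m N : ℕ) : ℤ) - (j : ℤ)) / (N : ℝ) ^ (m - j)) := by
  have hN1 : (1 : ℝ) ≤ N := by exact_mod_cast hN
  have hm1 : (1 : ℝ) ≤ m := by exact_mod_cast hm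
  set t := min m N with ht
  have htm : t ≤ m := min_le_left _ _
  have e1 : (N : ℝ) ^ (m - t) ≤ m ^ m := by
    rcases le_total m N with hmN | hNm
    · rw [ht, min_eq_left hmN, Nat.sub_self, pow_zero]
      exact one_le_pow₀ hm1
    · calc (N : ℝ) ^ (m - t) ≤ m ^ (m - t) := by gcongr
        _ ≤ m ^ m := pow_le_pow_right₀ hm1 (Nat.sub_le _ _)
  have e2 : (N : ℝ) ^ (m - j) ≤ m ^ m * (N : ℝ) ^ (t - i) := by
    calc (N : ℝ) ^ (m - j) ≤ (N : ℝ) ^ ((m - t) + (t - i)) := pow_le_pow_right₀ hN1 (by omega)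
      _ = (N : ℝ) ^ (m - t) * (N : ℝ) ^ (t - i) := pow_add _ _ _
      _ ≤ _ := by gcongr
  have e3 : h ^ (j - i) ≤ H ^ m :=
    (pow_le_pow_left₀ hh.le hhH _).trans (pow_le_pow_right₀ hH (by omega))
  have e4 : h ^ (t - i) * h ^ j = h ^ t * h ^ (j - i) := by
    rw [← pow_add, ← pow_add]; congr 1; omega
  rw [zpow_sub₀ hh.ne', zpow_natCast, zpow_natCast, div_pow, div_div, ← mul_div_assoc,
    div_le_div_iff₀ (by positivity) (by positivity)]
  calc h ^ (t - i) * (h ^ j * (N : ℝ) ^ (m - j))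
      = h ^ t * h ^ (j - i) * (N : ℝ) ^ (m - j) := by rw [← mul_assoc, e4]
    _ ≤ h ^ t * H ^ m * (m ^ m * (N : ℝ) ^ (t - i)) := by gcongr
    _ = _ := by ring

/-- Derivatives of order `i > t` are not approximated at all; then `N = t < m`, and the claimed rate
is bounded below. -/
lemma one_le_rate_of_lt {h H : ℝ} (hh : 0 < h) (hH : 1 ≤ H) (hhH : h ≤ H) {N m i j : ℕ}
    (hN : 0 < N) (hm : 1 ≤ m) (hij : i ≤ j) (hjm : j ≤ m) (hit : min m N < i) :
    1 ≤ H ^ m * m ^ m * (h ^ (((min m N : ℕ) : ℤ) - (j : ℤ)) / (N : ℝ) ^ (m - j)) := by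
  have hN1 : (1 : ℝ) ≤ N := by exact_mod_cast hN
  have hm1 : (1 : ℝ) ≤ m := by exact_mod_cast hm
  have hNm : N ≤ m := by omega
  set t := min m N with ht
  have e2 : (N : ℝ) ^ (m - j) ≤ m ^ m := by
    calc (N : ℝ) ^ (m - j) ≤ m ^ (m - j) := by gcongr
      _ ≤ m ^ m := pow_le_pow_right₀ hm1 (Nat.sub_le _ _)
  have e3 : h ^ (j - t) ≤ H ^ m :=
    (pow_le_pow_left₀ hh.le hhH _).trans (pow_le_pow_right₀ hH (by omega))
  have e4 : h ^ j = h ^ t * h ^ (j - t) := by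
    rw [← pow_add]; congr 1; omega
  rw [zpow_sub₀ hh.ne', zpow_natCast, zpow_natCast, div_div, ← mul_div_assoc,
    one_le_div (by positivity), e4]
  calc h ^ t * h ^ (j - t) * (N : ℝ) ^ (m - j) ≤ h ^ t * H ^ m * m ^ m := by gcongr
    _ = _ := by ring

/-- The part of a spectrum at frequencies of size at most `R`. -/
noncomputable def lowPart (R : ℝ) (W : Space n → ℂ) : Space n → ℂ :=
  (Metric.closedBall 0 R).indicator W

lemma isBand_lowPart {W : Space n → ℂ} (hW : StronglyMeasurable W) (h2 : MemLp W 2 volume)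
    (R : ℝ) : IsBand R (lowPart R W) where
  stronglyMeasurable := hW.indicator Metric.isClosed_closedBall.measurableSet
  memLp := h2.indicator Metric.isClosed_closedBall.measurableSet
  eq_zero ξ hξ := Set.indicator_of_notMem (by simpa using hξ) W

lemma eLpNorm_error_eq {W g : Space n → ℂ} (hW : StronglyMeasurable W) (h2 : MemLp W 2 volume)
    {α : Fin n → ℕ} (hg : IsSpectrum (fun ξ => symbol α ξ * W ξ) g) (R : ℝ) (q : ℕ)
    (y : Space n) :
    eLpNorm (fun b => g (b + y)
        - bandTaylor (fun ξ => symbol α ξ * lowPart R W ξ) q b (b + y)) 2 volume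
      = eLpNorm (fun ξ => errorMultiplier R q y ξ * (symbol α ξ * W ξ)) 2 volume := by
  rw [eLpNorm_sub_bandTaylor ((isBand_lowPart hW h2 R).mul (continuous_symbol α)) hg]
  classical
  congr 1
  ext ξ
  rw [errorMultiplier, lowPart, Set.indicator_apply, mem_closedBall_zero_iff]
  split_ifs <;> ring

/-- The mean square error, over all centres `b` and for a fixed offset `y`, in the derivative
`D^α`. -/
lemma eLpNorm_error_le {W U g : Space n → ℂ} {m : ℕ} (hm : 1 ≤ m) (h : IsSpectrum W U)
    (hW : StronglyMeasurable W)
    (hWm : ∀ k ≤ m, MemLp (fun ξ => (‖ξ‖ ^ k : ℝ) * W ξ) 2 volume)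
    {α : Fin n → ℕ} (hg : IsSpectrum (fun ξ => symbol α ξ * W ξ) g)
    {D η H : ℝ} (hD : 1 ≤ D) (hη : 0 < η) (hH : 1 ≤ H) (hηH : η ≤ H) {N j : ℕ} (hN : 0 < N)
    (hαj : ∑ i, α i ≤ j) (hjm : j ≤ m) {y : Space n} (hy : ‖y‖ ≤ D * η) :
    eLpNorm (fun b => g (b + y) - bandTaylor
        (fun ξ => symbol α ξ * lowPart (N / (8 * π * D * η)) W ξ) (N - ∑ i, α i) b (b + y)) 2 volume
      ≤ ENNReal.ofReal ((8 * π * D) ^ m * H ^ m * m ^ m * m ! *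
          (η ^ (((min m N : ℕ) : ℤ) - (j : ℤ)) / (N : ℝ) ^ (m - j))) *
        ∑ r ∈ Finset.Icc (min m N) m, sobolevSeminorm Set.univ r U := by
  rw [eLpNorm_error_eq hW h.memLp_spectrum hg]
  set i := ∑ i, α i with hi
  have hN' : (0 : ℝ) < N := by exact_mod_cast hN
  have hπ : 1 ≤ 2 * π := by linarith [Real.pi_gt_three]
  have h8D : 1 ≤ 8 * π * D := by nlinarith
  set X := η ^ (((min m N : ℕ) : ℤ) - (j : ℤ)) / (N : ℝ) ^ (m - j) with hX
  have hX0 : 0 ≤ X := by positivity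
  -- it suffices to bound the multiplier by the rate times `|2πξ|^r` for some `r` with `t ≤ r ≤ m`
  have main : ∀ r ∈ Finset.Icc (min m N) m,
      (∀ ξ, ‖errorMultiplier (N / (8 * π * D * η)) (N - i) y ξ‖ * ‖symbol α ξ‖
        ≤ (8 * π * D) ^ m * (H ^ m * m ^ m * X) * (2 * π * ‖ξ‖) ^ r) →
      eLpNorm (fun ξ => errorMultiplier (N / (8 * π * D * η)) (N - i) y ξ * (symbol α ξ * W ξ))
          2 volume
        ≤ ENNReal.ofReal ((8 * π * D) ^ m * H ^ m * m ^ m * m ! * X) *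
          ∑ r ∈ Finset.Icc (min m N) m, sobolevSeminorm Set.univ r U := by
    intro r hr hb
    have h1 := eLpNorm_le_mul_eLpNorm_of_ae_le_mul (p := 2) (μ := (volume : Measure (Space n)))
      (f := fun ξ => errorMultiplier (N / (8 * π * D * η)) (N - i) y ξ * (symbol α ξ * W ξ))
      (g := fun ξ => ((2 * π * ‖ξ‖) ^ r : ℝ) * W ξ)
      (c := (8 * π * D) ^ m * (H ^ m * m ^ m * X)) (.of_forall fun ξ => by
        rw [norm_mul, norm_mul, norm_mul, ← mul_assoc, ← mul_assoc, norm_real,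
          Real.norm_of_nonneg (by positivity)]
        exact mul_le_mul_of_nonneg_right (hb ξ) (norm_nonneg _))
    refine h1.trans ?_
    have h2 := h.eLpNorm_pow_le (Finset.mem_Icc.1 hr).2 hW hWm
    refine (mul_le_mul_right h2 _).trans ?_
    rw [← mul_assoc, ← ENNReal.ofReal_natCast, ← ENNReal.ofReal_mul (by positivity)]
    have e : (8 * π * D) ^ m * (H ^ m * m ^ m * X) * (m ! : ℝ)
        = (8 * π * D) ^ m * H ^ m * m ^ m * m ! * X := by ring
    rw [e]
    gcongr
    exact Finset.single_le_sum (f := fun r => sobolevSeminorm Set.univ r U)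
      (fun _ _ => zero_le) hr
  rcases le_or_gt i (min m N) with hit | hit
  · refine main (min m N) (Finset.mem_Icc.2 ⟨le_rfl, min_le_left _ _⟩) fun ξ => ?_
    have h1 := norm_errorMultiplier_le (m := m) hD hη hit (min_le_right m N) (min_le_left m N) hN
      hy ξ
    have h2 := norm_symbol_le α ξ
    have h3 := rate_le_of_le hη hH hηH hN hm hαj hjm hit
    calc _ ≤ (8 * π * D) ^ m * (η * ‖ξ‖ / N) ^ (min m N - i) * (2 * π * ‖ξ‖) ^ i := by gcongr
      _ = (8 * π * D) ^ m * (η / N) ^ (min m N - i)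
            * (‖ξ‖ ^ (min m N - i) * (2 * π * ‖ξ‖) ^ i) := by
          rw [mul_div_right_comm, mul_pow]; ring
      _ ≤ (8 * π * D) ^ m * (H ^ m * m ^ m * X)
            * ((2 * π * ‖ξ‖) ^ (min m N - i) * (2 * π * ‖ξ‖) ^ i) := by
          gcongr
          exact le_mul_of_one_le_left (norm_nonneg _) hπ
      _ = _ := by rw [← pow_add, Nat.sub_add_cancel hit]
  · refine main i (Finset.mem_Icc.2 ⟨hit.le, hαj.trans hjm⟩) fun ξ => ?_
    have hNi : N - i = 0 := by omega
    rw [hNi, norm_errorMultiplier_zero, one_mul]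
    refine (norm_symbol_le α ξ).trans (le_mul_of_one_le_left (by positivity) ?_)
    exact one_le_mul_of_one_le_of_one_le (one_le_pow₀ h8D)
      (one_le_rate_of_lt hη hH hηH hN hm hαj hjm hit)

end ErrorEstimate

/-! ### Broken norms -/

section Broken

open scoped Real

variable {n : ℕ}

lemma hasWeakDeriv_zero {G : Set (Space n)} {w : Space n → ℂ}
    (hw : LocallyIntegrableOn w G volume) : HasWeakDeriv G 0 w w where
  locallyIntegrable := hw
  locallyIntegrable_deriv := hw
  integral_eq φ _ := by
    have : ∀ l : List (Fin n), l.foldr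
        (fun i ψ => (partialDeriv i)^[(0 : Fin n → ℕ) i] ψ) φ = φ := by
      intro l
      induction l with
      | nil => rfl
      | cons i l ih => rw [List.foldr_cons, ih]; rfl
    rw [multiDeriv, this]
    simp

lemma eLpNorm_le_sobolevNorm {G : Set (Space n)} (hG : IsOpen G) {w : Space n → ℂ}
    (hw : LocallyIntegrableOn w G volume) (j : ℕ) :
    eLpNorm w 2 (volume.restrict G) ≤ sobolevNorm G j w := by
  rw [← ENNReal.pow_le_pow_left_iff two_ne_zero, sobolevNorm_sq,
    ← weakDerivNorm_eq hG (hasWeakDeriv_zero hw)]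
  exact Finset.single_le_sum (f := fun α => weakDerivNorm G α w ^ 2) (fun _ _ => zero_le)
    (mem_multiIndices.2 (by simp))

/-- The function that equals `f K` on each element `K` of the mesh, and `0` elsewhere. -/
noncomputable def meshFun (T : Set (Set (Space n))) (f : Set (Space n) → Space n → ℂ) :
    Space n → ℂ := by
  classical
  exact fun x => if hx : ∃ K ∈ T, x ∈ K then f hx.choose x else 0

lemma meshFun_eq {Ω : Set (Space n)} {T : Set (Set (Space n))} (hT : IsMesh Ω T)
    (f : Set (Space n) → Space n → ℂ) {K : Set (Space n)} (hK : K ∈ T) {x : Space n}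
    (hx : x ∈ K) : meshFun T f x = f K x := by
  have hex : ∃ K ∈ T, x ∈ K := ⟨K, hK, hx⟩
  have h1 : hex.choose = K := by
    by_contra hne
    have h2 := hT.disjoint _ hex.choose_spec.1 _ hK hne
    exact Set.notMem_empty x (h2 ▸ ⟨hex.choose_spec.2, hx⟩)
  rw [meshFun, dif_pos hex, h1]

lemma meshFun_ae_eq {Ω : Set (Space n)} {T : Set (Set (Space n))} (hT : IsMesh Ω T)
    (f : Set (Space n) → Space n → ℂ) {K : Set (Space n)} (hK : K ∈ T) :
    meshFun T f =ᵐ[volume.restrict K] f K :=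
  (ae_restrict_iff' (hT.isOpen K hK).measurableSet).2 (.of_forall fun _ hx => meshFun_eq hT f hK hx)

lemma IsMesh.restrict_eq {Ω : Set (Space n)} {T : Set (Set (Space n))} (hT : IsMesh Ω T) :
    volume.restrict Ω = volume.restrict (⋃ K : T, (K : Set (Space n))) := by
  refine Measure.restrict_congr_set ?_
  rw [← Set.biUnion_eq_iUnion T fun K _ => K]
  refine (ae_le_set.2 hT.cover).antisymm ?_
  exact (Set.iUnion₂_subset hT.subset).eventuallyLE

lemma IsMesh.lintegral_eq {Ω : Set (Space n)} {T : Set (Set (Space n))} (hT : IsMesh Ω T)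
    (f : Space n → ℝ≥0∞) : ∫⁻ x in Ω, f x = ∑' K : T, ∫⁻ x in (K : Set (Space n)), f x := by
  have : Countable T := hT.countable.to_subtype
  rw [hT.restrict_eq, lintegral_iUnion fun K : T => (hT.isOpen K K.2).measurableSet]
  intro K K' hKK
  exact Set.disjoint_iff_inter_eq_empty.2
    (hT.disjoint _ K.2 _ K'.2 fun h => hKK (Subtype.ext h))

/-- A function assembled from polynomials on the elements is square integrable as soon as its
distance to a square integrable function is finite in the broken norm. -/
lemma memLp_meshFun {Ω : Set (Space n)} {T : Set (Set (Space n))} (hT : IsMesh Ω T)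
    {U : Space n → ℂ} (hU : MemLp U 2 volume)
    {P : Set (Space n) → MvPolynomial (Fin n) ℂ} {j : ℕ}
    (hfin : ∑' K : T, sobolevNorm (K : Set (Space n)) j (U - polyFun (P K)) ^ 2 < ⊤) :
    MemLp (meshFun T fun K => polyFun (P K)) 2 (volume.restrict Ω) := by
  have : Countable T := hT.countable.to_subtype
  set v := meshFun T fun K => polyFun (P K) with hv
  have hvm : AEStronglyMeasurable v (volume.restrict Ω) := by
    rw [hT.restrict_eq, aestronglyMeasurable_iUnion_iff]
    exact fun K => ((contDiff_polyFun (P K)).continuous.aestronglyMeasurable).congr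
      (meshFun_ae_eq hT (fun K => polyFun (P K)) K.2).symm
  have hd : MemLp (U - v) 2 (volume.restrict Ω) := by
    refine ⟨(hU.restrict Ω).1.sub hvm, ?_⟩
    refine (ENNReal.pow_lt_top_iff (n := 2)).1 ?_ |>.resolve_right two_ne_zero
    rw [eLpNorm_two_sq, hT.lintegral_eq]
    refine (ENNReal.tsum_le_tsum fun K => ?_).trans_lt hfin
    have hloc : LocallyIntegrableOn (U - polyFun (P K)) K volume :=
      ((locallyIntegrable_of_memLp_two hU).locallyIntegrableOn _).sub
        ((contDiff_polyFun (P K)).continuous.locallyIntegrable.locallyIntegrableOn _)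
    have h1 := eLpNorm_le_sobolevNorm (hT.isOpen K K.2) hloc j
    rw [← eLpNorm_two_sq, eLpNorm_congr_ae ((ae_eq_refl U).sub (meshFun_ae_eq hT _ K.2))]
    gcongr
  have := (hU.restrict Ω).sub hd
  rwa [sub_sub_cancel] at this

/-- The total error of the local Taylor polynomials of the low-frequency part, for suitable
centres. -/
lemma exists_centers_error_le {W U : Space n → ℂ} {m : ℕ} (hm : 1 ≤ m) (hUW : IsSpectrum W U)
    (hW : StronglyMeasurable W)
    (hWm : ∀ k ≤ m, MemLp (fun ξ => (‖ξ‖ ^ k : ℝ) * W ξ) 2 volume)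
    {Ω : Set (Space n)} {T : Set (Set (Space n))} (hT : IsMesh Ω T) {h H : ℝ} (hh : 0 < h)
    (hH : 1 ≤ H) (hhH : h ≤ H) (hdiam : ∀ K ∈ T, ∀ x ∈ K, ∀ y ∈ K, dist x y ≤ h)
    {N j : ℕ} (hN : 0 < N) (hjm : j ≤ m) :
    ∃ (R : ℝ) (β : Set (Space n) → Space n),
      ∑' K : T, sobolevNorm (K : Set (Space n)) j
          (U - bandTaylor (lowPart R W) N (β K)) ^ 2
        ≤ ENNReal.ofReal (n + 2) ^ n * volume (Metric.ball (0 : Space n) 1)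
            * (multiIndices n j).card *
          (ENNReal.ofReal ((8 * π * (n + 2)) ^ m * H ^ m * m ^ m * m.factorial *
            (h ^ (((min m N : ℕ) : ℤ) - (j : ℤ)) / (N : ℝ) ^ (m - j))) *
          ∑ r ∈ Finset.Icc (min m N) m, sobolevSeminorm Set.univ r U) ^ 2 := by
  classical
  set R : ℝ := N / (8 * π * (n + 2) * h) with hR
  have hex : ∀ α : Fin n → ℕ, ∃ g : Space n → ℂ, StronglyMeasurable g ∧
      (α ∈ multiIndices n j → IsSpectrum (fun ξ => symbol α ξ * W ξ) g) := by
    intro α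
    by_cases hα : α ∈ multiIndices n j
    · obtain ⟨g, h1, h2⟩ :=
        exists_isSpectrum (memLp_symbol_mul hW hWm ((mem_multiIndices.1 hα).trans hjm))
      exact ⟨g, h1, fun _ => h2⟩
    · exact ⟨0, stronglyMeasurable_zero, fun h' => absurd h' hα⟩
  choose g hgm hg using hex
  have hband := isBand_lowPart hW hUW.memLp_spectrum R
  set e : (Fin n → ℕ) → Space n × Space n → ℂ := fun α z => g α z.2
    - bandTaylor (fun ξ => symbol α ξ * lowPart R W ξ) (N - ∑ i, α i) z.1 z.2 with he
  have hem : ∀ α, Measurable (e α) := fun α =>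
    ((hgm α).measurable.comp measurable_snd).sub (stronglyMeasurable_bandTaylor
      (hband.mul (continuous_symbol α)).stronglyMeasurable _).measurable
  set E : Space n × Space n → ℝ≥0∞ := fun z => ∑ α ∈ multiIndices n j, ‖e α z‖ₑ ^ 2 with hE
  have hEm : Measurable E := Finset.measurable_sum _ fun α _ => ((hem α).enorm).pow_const 2
  obtain ⟨β, hβ⟩ := exists_centers hh hT.countable hT.nonempty hT.isOpen hT.disjoint hdiam hEm
  refine ⟨R, β, ?_⟩
  have h1 : ∀ K : T, sobolevNorm (K : Set (Space n)) j
      (U - bandTaylor (lowPart R W) N (β K)) ^ 2 = ∫⁻ x in (K : Set (Space n)), E (β K, x) := by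
    intro K
    have hmeas : ∀ α ∈ multiIndices n j, Measurable fun x => ‖e α (β K, x)‖ₑ ^ 2 := fun α _ =>
      (((hem α).comp measurable_prodMk_left).enorm).pow_const 2
    rw [sobolevNorm_sq, lintegral_finsetSum _ hmeas]
    refine Finset.sum_congr rfl fun α hα => ?_
    rw [weakDerivNorm_eq (hT.isOpen K K.2)
      (((hUW.hasWeakDeriv (hg α hα)).mono (Set.subset_univ _)).sub
        (hasWeakDeriv_bandTaylor hband N (β K) α K)), eLpNorm_two_sq]
    rfl
  simp_rw [h1]
  refine hβ.trans ?_
  set B := ENNReal.ofReal ((8 * π * (n + 2)) ^ m * H ^ m * m ^ m * m.factorial *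
            (h ^ (((min m N : ℕ) : ℤ) - (j : ℤ)) / (N : ℝ) ^ (m - j))) *
          ∑ r ∈ Finset.Icc (min m N) m, sobolevSeminorm Set.univ r U with hB
  have h2 : ∀ y ∈ Metric.ball (0 : Space n) ((n + 2) * h),
      ∫⁻ b, E (b, b + y) ≤ (multiIndices n j).card * B ^ 2 := by
    intro y hy
    have hmeas : ∀ α ∈ multiIndices n j, Measurable fun b => ‖e α (b, b + y)‖ₑ ^ 2 := fun α _ =>
      (((hem α).comp (by fun_prop : Measurable fun b : Space n => (b, b + y))).enorm).pow_const 2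
    rw [lintegral_finsetSum _ hmeas, ← nsmul_eq_mul, ← Finset.sum_const]
    refine Finset.sum_le_sum fun α hα => ?_
    rw [← eLpNorm_two_sq volume fun b => e α (b, b + y)]
    gcongr
    exact eLpNorm_error_le hm hUW hW hWm (hg α hα) (by linarith [Nat.cast_nonneg (α := ℝ) n]) hh
      hH hhH hN (mem_multiIndices.1 hα) hjm (by simpa using (mem_ball_zero_iff.1 hy).le)
  have h3 : ∫⁻ y in Metric.ball (0 : Space n) ((n + 2) * h), ∫⁻ b, E (b, b + y)
      ≤ (multiIndices n j).card * B ^ 2 * volume (Metric.ball (0 : Space n) ((n + 2) * h)) := by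
    rw [← setLIntegral_const]
    exact setLIntegral_mono' Metric.isOpen_ball.measurableSet h2
  have h4 : volume (Metric.ball (0 : Space n) ((n + 2) * h))
      = ENNReal.ofReal (n + 2) ^ n * ENNReal.ofReal h ^ n
        * volume (Metric.ball (0 : Space n) 1) := by
    rw [Measure.addHaar_ball_of_pos _ _ (by positivity), finrank_euclideanSpace_fin,
      ENNReal.ofReal_pow (by positivity), ENNReal.ofReal_mul (by positivity), mul_pow]
  have hv0 : ENNReal.ofReal h ^ n ≠ 0 := pow_ne_zero _ (by simpa using hh)
  have hvt : ENNReal.ofReal h ^ n ≠ ⊤ := ENNReal.pow_ne_top ENNReal.ofReal_ne_top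
  calc (ENNReal.ofReal h ^ n)⁻¹ *
        ∫⁻ y in Metric.ball (0 : Space n) ((n + 2) * h), ∫⁻ b, E (b, b + y)
      ≤ (ENNReal.ofReal h ^ n)⁻¹ * ((multiIndices n j).card * B ^ 2 *
          (ENNReal.ofReal (n + 2) ^ n * ENNReal.ofReal h ^ n
            * volume (Metric.ball (0 : Space n) 1))) := by
        rw [← h4]
        gcongr
    _ = ((ENNReal.ofReal h ^ n)⁻¹ * ENNReal.ofReal h ^ n) * (ENNReal.ofReal (n + 2) ^ n
          * volume (Metric.ball (0 : Space n) 1) * (multiIndices n j).card * B ^ 2) := by ring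
    _ = _ := by rw [ENNReal.inv_mul_cancel hv0 hvt, one_mul]

/-- Minimizing on every element separately produces a minimizer of the broken norm. -/
lemma exists_isMinOn_brokenNorm {Ω : Set (Space n)} {T : Set (Set (Space n))} (hT : IsMesh Ω T)
    {u U : Space n → ℂ} (hU : MemLp U 2 volume) (huU : U =ᵐ[volume.restrict Ω] u) {p j : ℕ}
    (hder : ∀ α ∈ multiIndices n j, ∃ g, HasWeakDeriv Set.univ α U g ∧ MemLp g 2 volume)
    {Q : Set (Space n) → MvPolynomial (Fin n) ℂ} (hQ : ∀ K, (Q K).totalDegree ≤ p)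
    (hfin : ∑' K : T, sobolevNorm (K : Set (Space n)) j (U - polyFun (Q K)) ^ 2 < ⊤) :
    ∃ v ∈ piecewisePoly Ω T p,
      IsMinOn (fun w => brokenNorm T j (u - w)) (piecewisePoly Ω T p) v ∧
      brokenNorm T j (u - v) ≤
        (∑' K : T, sobolevNorm (K : Set (Space n)) j (U - polyFun (Q K)) ^ 2) ^ (1 / 2 : ℝ) := by
  have hex : ∀ K : Set (Space n), ∃ P : MvPolynomial (Fin n) ℂ, P.totalDegree ≤ p ∧ (K ∈ T →
      ∀ P' : MvPolynomial (Fin n) ℂ, P'.totalDegree ≤ p →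
        sobolevNorm K j (U - polyFun P) ≤ sobolevNorm K j (U - polyFun P')) := by
    intro K
    by_cases hK : K ∈ T
    · obtain ⟨P, h1, h2⟩ := exists_best_approximation (hT.bounded K hK) (hT.isOpen K hK) p
        (u := U) (j := j) fun α hα => by
          obtain ⟨g, hg, hgm⟩ := hder α hα
          exact ⟨g, hg.mono (Set.subset_univ _), hgm.restrict K⟩
      exact ⟨P, h1, fun _ => h2⟩
    · exact ⟨0, by simp, fun h => absurd h hK⟩
  choose P hP hmin using hex
  have hle : ∀ K : T, sobolevNorm (K : Set (Space n)) j (U - polyFun (P K)) ^ 2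
      ≤ sobolevNorm (K : Set (Space n)) j (U - polyFun (Q K)) ^ 2 := by
    intro K
    gcongr
    exact hmin K K.2 _ (hQ K)
  have hu : ∀ K ∈ T, u =ᵐ[volume.restrict K] U := fun K hK =>
    ae_restrict_of_ae_restrict_of_subset (hT.subset K hK) huU.symm
  have hcongr : ∀ K : T, ∀ {w : Space n → ℂ} {P' : MvPolynomial (Fin n) ℂ},
      w =ᵐ[volume.restrict (K : Set (Space n))] polyFun P' →
      sobolevNorm (K : Set (Space n)) j (u - w)
        = sobolevNorm (K : Set (Space n)) j (U - polyFun P') :=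
    fun K w P' hw => sobolevNorm_congr ((hu K K.2).sub hw)
  set v := meshFun T fun K => polyFun (P K) with hv
  have hvK : ∀ K : T, v =ᵐ[volume.restrict (K : Set (Space n))] polyFun (P K) := fun K =>
    meshFun_ae_eq hT (fun K => polyFun (P K)) K.2
  refine ⟨v, ⟨?_, ?_⟩, ?_, ?_⟩
  · exact memLp_meshFun hT hU ((ENNReal.tsum_le_tsum hle).trans_lt hfin)
  · exact fun K hK => ⟨P K, hP K, hvK ⟨K, hK⟩⟩
  · rintro w ⟨-, hw⟩
    simp only [Set.mem_ofPred_eq, brokenNorm]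
    gcongr with K
    obtain ⟨P', hP', hwP⟩ := hw K K.2
    rw [hcongr K (hvK K), hcongr K hwP]
    exact hmin K K.2 _ hP'
  · rw [brokenNorm]
    gcongr with K
    rw [hcongr K (hvK K)]
    exact hmin K K.2 _ (hQ K)

end Broken

end PiecewisePoly

theorem theorem2p5 (n m : ℕ) (hn : 1 ≤ n) (hm : 1 ≤ m) (h₀ : ℝ) (hh₀ : 0 < h₀) :
    ∃ C : ℝ, 0 < C ∧
      ∀ (Ω : Set (PiecewisePoly.Space n)), IsOpen Ω → Ω.Nonempty →
      ∀ (T : Set (Set (PiecewisePoly.Space n))), PiecewisePoly.IsMesh Ω T →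
      ∀ h : ℝ, 0 < h → h ≤ h₀ → PiecewisePoly.meshWidth T = ENNReal.ofReal h →
      ∀ u : PiecewisePoly.Space n → ℂ, PiecewisePoly.MemHOn m Ω u →
      ∀ U : PiecewisePoly.Space n → ℂ, PiecewisePoly.MemH m U →
        U =ᵐ[volume.restrict Ω] u →
      ∀ p j : ℕ, j ≤ m →
        ∃ v ∈ PiecewisePoly.piecewisePoly Ω T p,
          IsMinOn (fun w => PiecewisePoly.brokenNorm T j (u - w))
            (PiecewisePoly.piecewisePoly Ω T p) v ∧
          PiecewisePoly.brokenNorm T j (u - v) ≤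
            ENNReal.ofReal
                (C * (h ^ (((min m (p + 1) : ℕ) : ℤ) - (j : ℤ)) / ((p : ℝ) + 1) ^ (m - j))) *
              ∑ r ∈ Finset.Icc (min m (p + 1)) m,
                PiecewisePoly.sobolevSeminorm Set.univ r U := by
  
  classical
  -- `c₁` comes from the multiplier bound, `c₂` from the number of multi-indices and from the ratio
  -- between the volumes of the ball of radius `(n + 2) * h` and of a grid cell
  set H : ℝ := max 1 h₀ with hH
  set c₁ : ℝ := (8 * Real.pi * (n + 2)) ^ m * H ^ m * m ^ m * m.factorial with hc₁
  have hm' : (0 : ℝ) < m := by exact_mod_cast hm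
  have hH1 : 1 ≤ H := le_max_left _ _
  have hc₁0 : 0 < c₁ := by positivity
  set M : ℝ≥0∞ := ENNReal.ofReal (n + 2) ^ n *
    volume (Metric.ball (0 : PiecewisePoly.Space n) 1) *
    (PiecewisePoly.multiIndices n m).card with hM
  have hMt : M ≠ ⊤ := ENNReal.mul_ne_top (ENNReal.mul_ne_top (ENNReal.pow_ne_top
    ENNReal.ofReal_ne_top) measure_ball_lt_top.ne) (ENNReal.natCast_ne_top _)
  set c₂ : ℝ := (M ^ (1 / 2 : ℝ)).toReal with hc₂
  have hMc : M ^ (1 / 2 : ℝ) = ENNReal.ofReal c₂ :=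
    (ENNReal.ofReal_toReal (ENNReal.rpow_ne_top_of_nonneg (by norm_num) hMt)).symm
  have hc₂0 : 0 ≤ c₂ := ENNReal.toReal_nonneg
  refine ⟨(c₂ + 1) * c₁, by positivity, ?_⟩
  intro Ω hΩo hΩne T hT h hh hhh₀ hmesh u hu U hU huU p j hj
  obtain ⟨W, hW, hUW, hWm⟩ := hU.exists_isSpectrum
  have hdiam : ∀ K ∈ T, ∀ x ∈ K, ∀ y ∈ K, dist x y ≤ h := by
    intro K hK x hx y hy
    have h1 : edist x y ≤ ENNReal.ofReal h := by
      rw [← hmesh]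
      exact (Metric.edist_le_ediam_of_mem hx hy).trans
        (le_iSup₂ (f := fun (K : Set (PiecewisePoly.Space n)) (_ : K ∈ T) => Metric.ediam K) K hK)
    rwa [edist_dist, ENNReal.ofReal_le_ofReal_iff hh.le] at h1
  obtain ⟨R, β, hβ⟩ := PiecewisePoly.exists_centers_error_le hm hUW hW hWm hT hh hH1
    (hhh₀.trans (le_max_right _ _)) hdiam (Nat.succ_pos p) hj
  choose Q hQ hQβ using fun K => PiecewisePoly.exists_polyFun_eq_bandTaylor
    (PiecewisePoly.isBand_lowPart hW hUW.memLp_spectrum R) (le_refl (p + 1)) (β K)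
  simp_rw [← hQβ] at hβ
  set X : ℝ := h ^ (((min m (p + 1) : ℕ) : ℤ) - (j : ℤ)) / ((p : ℝ) + 1) ^ (m - j) with hX
  set S : ℝ≥0∞ := ∑ r ∈ Finset.Icc (min m (p + 1)) m,
    PiecewisePoly.sobolevSeminorm Set.univ r U with hS
  have hX0 : 0 ≤ X := by positivity
  have hSt : S < ⊤ := ENNReal.sum_lt_top.2 fun r hr =>
    hUW.sobolevSeminorm_lt_top (Finset.mem_Icc.1 hr).2 hW hWm
  have hcard : ((PiecewisePoly.multiIndices n j).card : ℝ≥0∞)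
      ≤ (PiecewisePoly.multiIndices n m).card := by
    exact_mod_cast Finset.card_le_card fun α hα => PiecewisePoly.mem_multiIndices.2
      ((PiecewisePoly.mem_multiIndices.1 hα).trans hj)
  have hsum : ∑' K : T, PiecewisePoly.sobolevNorm (K : Set (PiecewisePoly.Space n)) j
      (U - PiecewisePoly.polyFun (Q K)) ^ 2 ≤ M * (ENNReal.ofReal (c₁ * X) * S) ^ 2 := by
    refine hβ.trans (mul_le_mul' ?_ (by rw [Nat.cast_succ]))
    rw [hM]
    gcongr
  have hfin : ∑' K : T, PiecewisePoly.sobolevNorm (K : Set (PiecewisePoly.Space n)) j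
      (U - PiecewisePoly.polyFun (Q K)) ^ 2 < ⊤ :=
    hsum.trans_lt (ENNReal.mul_lt_top hMt.lt_top
      (ENNReal.pow_lt_top (ENNReal.mul_lt_top ENNReal.ofReal_lt_top hSt)))
  obtain ⟨v, hv, hvmin, hvle⟩ := PiecewisePoly.exists_isMinOn_brokenNorm hT hUW.memLp huU
    (p := p) (j := j) (fun α hα => by
      obtain ⟨g, -, hg⟩ := PiecewisePoly.exists_isSpectrum (PiecewisePoly.memLp_symbol_mul hW hWm
        ((PiecewisePoly.mem_multiIndices.1 hα).trans hj))
      exact ⟨g, hUW.hasWeakDeriv hg, hg.memLp⟩) hQ hfin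
  refine ⟨v, hv, hvmin, hvle.trans ?_⟩
  calc _ ≤ (M * (ENNReal.ofReal (c₁ * X) * S) ^ 2) ^ (1 / 2 : ℝ) := by gcongr
    _ = M ^ (1 / 2 : ℝ) * (ENNReal.ofReal (c₁ * X) * S) := by
        rw [ENNReal.mul_rpow_of_nonneg _ _ (by norm_num), ← ENNReal.rpow_natCast_mul]
        norm_num
    _ = ENNReal.ofReal (c₂ * (c₁ * X)) * S := by
        rw [hMc, ← mul_assoc, ← ENNReal.ofReal_mul hc₂0]
    _ ≤ _ := by
        gcongr ENNReal.ofReal ?_ * _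
        linarith [mul_nonneg hc₁0.le hX0]
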